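/- Let $L$ be the Rieger–Nishimura lattice: its elements are a top element $1$ and elements $a_{ij}$ with $i\in\mathbb N$, $0\le j\le 3$, $(i,j)\ne(0,0)$, where the order on the $a_{ij}$ is generated by the covers $a_{ij}<a_{i,j+1}$ and $a_{i,j+1}<a_{i+1,j}$ (so $a_{01}=0$ is the least element). Let $\mathcal K^*(L)$ be the set of all strictly increasing sequences $x_0<x_1<\cdots$ in $L$ that are either finite and of even length (possibly empty) or infinite (indexed by $\mathbb N$). Let $\ell(x)$ be half the length of $x$ if $x$ is finite, and $\omega$ if it is infinite. Put $x\sqsubseteq y$ if for each $i<\ell(x)$ there is $j<\ell(y)$ with $y_{2j}\le x_{2i}<x_{2i+1}\le y_{2j+1}$. For finite $x$ let $x^\perp$ be the increasing sequence whose set of terms is the symmetric difference of the set of terms of $x$ with $\{0,1\}$; for infinite $x$ let it be the one whose set of terms is the symmetric difference of the set of terms of $x$ with $\{0\}$. Theorem. $(\mathcal K^*(L),\sqsubseteq)$ is a complete lattice whose least element is the empty sequence and whose greatest element is the sequence $0<1$. With $\perp$ it is an orthomodular lattice, that is, $\perp$ is an order-inverting operation of period two, $x^\perp$ is a complement of $x$,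 and $x\sqsubseteq y$ implies $x\sqcup(x^\perp\sqcap y)=y$. Moreover, $\mathcal K^*(L)$ 1. is directly irreducible: it has more than one element, and whenever it is isomorphic to a product of two orthomodular lattices, one of the factors has only one element; 2. is algebraic: every element is a join of compact elements; 3. has the 2-covering property: it is atomic, and for each atom $a$ and each element $x$, every chain in the interval $[x,x\sqcup a]$ has at most $3$ elements; 4. has infinite height: there is no finite bound on the cardinality of its chains. -/

import Mathlib

universe u

/-! ### Orthomodular lattices -/

/-- `perp` makes the bounded lattice `α` an orthomodular lattice: it is an order-inverting,
period-two operation, `perp x` is a complement of `x`, and the orthomodular law holds. -/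
structure IsOrthomodular {α : Type u} [Lattice α] [BoundedOrder α] (perp : α → α) : Prop where
  antitone : ∀ x y, x ≤ y → perp y ≤ perp x
  involutive : ∀ x, perp (perp x) = x
  isCompl : ∀ x, IsCompl x (perp x)
  orthomodular : ∀ x y, x ≤ y → x ⊔ (perp x ⊓ y) = y

/-- The orthomodular lattice `(α, perp)` is directly irreducible: it has more than one element,
and whenever it is isomorphic, as an orthocomplemented lattice, to a product of two orthomodular
lattices, one of the two factors has only one element. -/
def IsDirectlyIrreducible {α : Type u} [Lattice α] [BoundedOrder α] (perp : α → α) : Prop :=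
  Nontrivial α ∧
    ∀ (β γ : Type u) [Lattice β] [BoundedOrder β] [Lattice γ] [BoundedOrder γ]
      (perpβ : β → β) (perpγ : γ → γ), IsOrthomodular perpβ → IsOrthomodular perpγ →
      ∀ f : α ≃o β × γ, (∀ x, f (perp x) = (perpβ (f x).1, perpγ (f x).2)) →
        Subsingleton β ∨ Subsingleton γ

/-! ### Height and covering properties -/

/-- Every chain of `α` has at most `n + 1` elements. -/
def HeightAtMost (α : Type u) [PartialOrder α] (n : ℕ) : Prop :=
  ∀ s : Set α, IsChain (· ≤ ·) s → s.encard ≤ n + 1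

/-- There is a finite bound on the cardinality of the chains of `α`. -/
def HasFiniteHeight (α : Type u) [PartialOrder α] : Prop :=
  ∃ n : ℕ, HeightAtMost α n

/-- The `n`-covering property: `α` is atomic, and for every atom `a` and every `x` the interval
`[x, x ⊔ a]` has height at most `n`. -/
def HasCoveringProperty (α : Type u) [Lattice α] [BoundedOrder α] (n : ℕ) : Prop :=
  IsAtomic α ∧ ∀ a x : α, IsAtom a → HeightAtMost (Set.Icc x (x ⊔ a)) n

/-! ### The extended Kalmbach construction -/

/-- Admissible sequences in `L`: strictly increasing sequences in `L` that are either finite and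
of even length, or infinite (indexed by `ℕ`). -/
inductive KalmbachStar (L : Type u) [PartialOrder L] : Type u
  | fin (s : List L) (hs : s.Pairwise (· < ·)) (he : Even s.length) : KalmbachStar L
  | inf (s : ℕ → L) (hs : StrictMono s) : KalmbachStar L

/-- Insert `⊥` in front of the list if it does not occur in it, and remove it if it does. -/
noncomputable def toggleBot {L : Type u} [PartialOrder L] [BoundedOrder L] (s : List L) : List L :=
  open Classical in if ⊥ ∈ s then s.filter (fun a => a ≠ ⊥) else ⊥ :: s

/-- Insert `⊤` at the end of the list if it does not occur in it, and remove it if it does. -/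
noncomputable def toggleTop {L : Type u} [PartialOrder L] [BoundedOrder L] (s : List L) : List L :=
  open Classical in if ⊤ ∈ s then s.filter (fun a => a ≠ ⊤) else s ++ [⊤]

theorem pairwise_toggleBot {L : Type u} [PartialOrder L] [BoundedOrder L] {s : List L}
    (hs : s.Pairwise (· < ·)) : (toggleBot s).Pairwise (· < ·) := by
  classical
  unfold toggleBot
  split_ifs with h
  · exact hs.filter _
  · refine List.pairwise_cons.2 ⟨fun a ha => bot_lt_iff_ne_bot.2 ?_, hs⟩
    rintro rfl
    exact h ha

theorem pairwise_toggleTop {L : Type u} [PartialOrder L] [BoundedOrder L] {s : List L}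
    (hs : s.Pairwise (· < ·)) : (toggleTop s).Pairwise (· < ·) := by
  classical
  unfold toggleTop
  split_ifs with h
  · exact hs.filter _
  · refine List.pairwise_append.2 ⟨hs, List.pairwise_singleton _ _, fun a ha b hb => ?_⟩
    obtain rfl := List.mem_singleton.1 hb
    refine lt_top_iff_ne_top.2 ?_
    rintro rfl
    exact h ha

theorem length_filter_ne_add_one {L : Type u} [DecidableEq L] {s : List L} (hs : s.Nodup) {a : L}
    (ha : a ∈ s) : (s.filter (fun b => b ≠ a)).length + 1 = s.length := by
  have h : s.filter (fun b => b ≠ a) = s.erase a := by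
    rw [hs.erase_eq_filter]
    congr 1
    funext b
    by_cases hb : b = a <;> simp [hb]
  rw [h, List.length_erase_of_mem ha]
  have := List.length_pos_of_mem ha
  omega

theorem even_length_toggleBot {L : Type u} [PartialOrder L] [BoundedOrder L] {s : List L}
    (hs : s.Pairwise (· < ·)) : Even (toggleBot s).length ↔ ¬ Even s.length := by
  classical
  unfold toggleBot
  split_ifs with h
  · have := length_filter_ne_add_one (hs.imp (fun h => h.ne)) h
    rw [← this, Nat.even_add_one, not_not]
  · rw [List.length_cons, Nat.even_add_one]

theorem even_length_toggleTop {L : Type u} [PartialOrder L] [BoundedOrder L] {s : List L}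
    (hs : s.Pairwise (· < ·)) : Even (toggleTop s).length ↔ ¬ Even s.length := by
  classical
  unfold toggleTop
  split_ifs with h
  · have := length_filter_ne_add_one (hs.imp (fun h => h.ne)) h
    rw [← this, Nat.even_add_one, not_not]
  · rw [List.length_append, List.length_singleton, Nat.even_add_one]

namespace KalmbachStar

/-- The term of index `k` of an admissible sequence, if there is one. -/
def term {L : Type u} [PartialOrder L] : KalmbachStar L → ℕ → Option L
  | fin s _ _, k => s[k]?
  | inf s _, k => some (s k)

/-- The order of the construction: every interval `[x₂ᵢ, x₂ᵢ₊₁]` is contained in an interval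
`[y₂ⱼ, y₂ⱼ₊₁]`. -/
def Below {L : Type u} [PartialOrder L] (x y : KalmbachStar L) : Prop :=
  ∀ (i : ℕ) (a b : L), x.term (2 * i) = some a → x.term (2 * i + 1) = some b →
    ∃ (j : ℕ) (c d : L), y.term (2 * j) = some c ∧ y.term (2 * j + 1) = some d ∧ c ≤ a ∧ b ≤ d

/-- The empty sequence. -/
def zero (L : Type u) [PartialOrder L] : KalmbachStar L :=
  fin [] List.Pairwise.nil (by simp)

/-- The sequence `0 < 1`. -/
def one (L : Type u) [PartialOrder L] [BoundedOrder L] [Nontrivial L] : KalmbachStar L :=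
  fin [⊥, ⊤] (by simp [bot_lt_top]) (by simp)

/-- The orthocomplement: for a finite sequence, the increasing sequence whose set of terms is the
symmetric difference of the set of terms with `{0, 1}`; for an infinite sequence, the one whose set
of terms is the symmetric difference of the set of terms with `{0}`. -/
noncomputable def perp {L : Type u} [PartialOrder L] [BoundedOrder L] : KalmbachStar L → KalmbachStar L
  | fin s hs he => fin (toggleTop (toggleBot s)) (pairwise_toggleTop (pairwise_toggleBot hs)) (by
      rw [even_length_toggleTop (pairwise_toggleBot hs), even_length_toggleBot hs, not_not]
      exact he)
  | inf s hs => open Classical in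
      if h : s 0 = ⊥ then inf (fun n => s (n + 1)) (fun _ _ hmn => hs (Nat.add_lt_add_right hmn 1))
      else inf (fun n => Nat.casesOn n ⊥ s) (by
        refine strictMono_nat_of_lt_succ fun n => ?_
        cases n with
        | zero => exact bot_lt_iff_ne_bot.2 h
        | succ n => exact hs (Nat.lt_succ_self n))

end KalmbachStar

/-! ### The Rieger-Nishimura lattice -/

/-- The elements other than the top of the Rieger-Nishimura lattice: `aᵢⱼ` with `i ∈ ℕ`,
`0 ≤ j ≤ 3` and `(i, j) ≠ (0, 0)`. -/
@[ext]
structure RNNode : Type where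
  i : ℕ
  j : ℕ
  j_le : j ≤ 3
  ne_zero : ¬ (i = 0 ∧ j = 0)

namespace RNNode

/-- The edges of the Hasse diagram: `aᵢⱼ < aᵢ₍ⱼ₊₁₎` and `aᵢ₍ⱼ₊₁₎ < a₍ᵢ₊₁₎ⱼ`. -/
def Edge (a b : RNNode) : Prop :=
  (b.i = a.i ∧ b.j = a.j + 1) ∨ (b.i = a.i + 1 ∧ a.j = b.j + 1)

instance : LE RNNode := ⟨fun a b => a.i ≤ b.i ∧ a.i + a.j ≤ b.i + b.j⟩

theorem le_def {a b : RNNode} : a ≤ b ↔ a.i ≤ b.i ∧ a.i + a.j ≤ b.i + b.j := Iff.rfl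

instance : PartialOrder RNNode where
  le_refl a := ⟨le_rfl, le_rfl⟩
  le_trans a b c h₁ h₂ := ⟨h₁.1.trans h₂.1, h₁.2.trans h₂.2⟩
  le_antisymm a b h₁ h₂ := by
    obtain ⟨h₁, h₃⟩ := h₁
    obtain ⟨h₂, h₄⟩ := h₂
    ext <;> omega

/-- The order is the one generated by the edges of the Hasse diagram. -/
theorem le_iff_reflTransGen {a b : RNNode} : a ≤ b ↔ Relation.ReflTransGen Edge a b := by
  constructor
  · intro h
    obtain ⟨n, hn⟩ : ∃ n : ℕ, n = (b.i + (b.i + b.j)) - (a.i + (a.i + a.j)) := ⟨_, rfl⟩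
    induction n generalizing a with
    | zero =>
      rw [le_def] at h
      have : a = b := by ext <;> omega
      exact this ▸ Relation.ReflTransGen.refl
    | succ n ih =>
      rw [le_def] at h
      have hb := b.j_le
      have ha := a.j_le
      have h0 := a.ne_zero
      by_cases hc : a.i < b.i ∧ 0 < a.j
      · refine Relation.ReflTransGen.head
          (b := ⟨a.i + 1, a.j - 1, by omega, by omega⟩) (Or.inr ?_) (ih ?_ ?_)
        · exact ⟨rfl, by change a.j = a.j - 1 + 1; omega⟩
        · rw [le_def]; dsimp only; omega
        · dsimp only; omega
      · refine Relation.ReflTransGen.head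
          (b := ⟨a.i, a.j + 1, by omega, by omega⟩) (Or.inl ⟨rfl, rfl⟩) (ih ?_ ?_)
        · rw [le_def]; dsimp only; omega
        · dsimp only; omega
  · intro h
    induction h with
    | refl => exact le_rfl
    | tail _ h ih => exact ih.trans (by rw [le_def]; rcases h with h | h <;> omega)

/-- The covering pairs are the edges of the Hasse diagram. -/
theorem covBy_iff_edge {a b : RNNode} : a ⋖ b ↔ Edge a b := by
  constructor
  · intro h
    rcases Relation.ReflTransGen.cases_head (le_iff_reflTransGen.1 h.le) with rfl | ⟨c, hc, hcb⟩
    · exact (lt_irrefl _ h.lt).elim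
    · have hac : a ≠ c := by
        rintro rfl
        rcases hc with hc | hc <;> omega
      have hle : a ≤ c := le_iff_reflTransGen.2 (Relation.ReflTransGen.single hc)
      rcases h.eq_or_eq hle (le_iff_reflTransGen.2 hcb) with e | e
      · exact (hac e.symm).elim
      · exact e ▸ hc
  · intro h
    have hle : a ≤ b := le_iff_reflTransGen.2 (Relation.ReflTransGen.single h)
    refine ⟨lt_of_le_of_ne hle ?_, fun c h₁ h₂ => ?_⟩
    · rintro rfl
      rcases h with h | h <;> omega
    · have e₁ := le_def.1 h₁.le
      have e₂ := le_def.1 h₂.le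
      have n₁ := mt le_def.2 h₁.not_ge
      have n₂ := mt le_def.2 h₂.not_ge
      rcases h with h | h <;> omega

instance : Lattice RNNode where
  sup a b := ⟨max a.i b.i, max (a.i + a.j) (b.i + b.j) - max a.i b.i,
    by have := a.j_le; have := b.j_le; omega, by have := a.ne_zero; have := b.ne_zero; omega⟩
  inf a b := ⟨min a.i b.i, min (a.i + a.j) (b.i + b.j) - min a.i b.i,
    by have := a.j_le; have := b.j_le; omega, by have := a.ne_zero; have := b.ne_zero; omega⟩
  le_sup_left a b := by rw [le_def]; dsimp only; omega
  le_sup_right a b := by rw [le_def]; dsimp only; omega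
  sup_le a b c h₁ h₂ := by rw [le_def] at *; dsimp only; omega
  inf_le_left a b := by rw [le_def]; dsimp only; omega
  inf_le_right a b := by rw [le_def]; dsimp only; omega
  le_inf a b c h₁ h₂ := by rw [le_def] at *; dsimp only; omega

instance : OrderBot RNNode where
  bot := ⟨0, 1, by omega, by omega⟩
  bot_le a := by
    rw [le_def]
    have := a.ne_zero
    dsimp only
    omega

end RNNode

/-- The Rieger-Nishimura lattice: the elements `aᵢⱼ` together with a top element. -/
abbrev RiegerNishimura : Type := WithTop RNNode

/-! ### Families of intervals -/

/-! A sequence in `WithTop N` is determined by the nondegenerate intervals of `N` that lie inside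
one of its intervals [x₂ᵢ, x₂ᵢ₊₁], and ⊑ becomes inclusion of these families. If `N` has no maximal
element and all but finitely many of its elements lie above any given one, the families that arise
are exactly those closed under subintervals and under merging intervals that are not strictly
separated (`KalmbachStar.familyIso`). Intersections of such families are again such families, whence
completeness; so are directed unions, whence single intervals are compact and the lattice is
algebraic.

Membership of [a, b] is a parity condition on the number of terms ≤ a. Toggling 0 flips the parity,
so x^⊥ corresponds to the family of intervals not overlapping x (`family_perp`). Orthomodularity
reduces to `le_of_orth_inf_eq_bot`: if D ≤ E and no interval of E avoids D, then E ≤ D.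
Well-foundedness locates left ends of maximal intervals; cofiniteness handles right ends that never
stop growing.

Atoms are the intervals [c, d] with c ⋖ d. Each step of a chain from D to D ⊔ [c, d] contributes a
cover that overlaps [c, d] but none of the earlier ones, so these covers are linearly ordered. In
the coordinates (x, y) = (i, i + j) the order is componentwise on the strip x ≤ y ≤ x + 3, and the
narrowness of the strip leaves room for only two of them (`exists_rank_between`). A direct
decomposition would split the covers into two classes with no overlap between them, but overlaps
link all covers (`eq_top_of_rel`). The intervals [0, x] give an infinite chain. -/

/-- A lattice in which all but finitely many elements lie above any given element. -/
class CofiniteAbove (N : Type u) [LE N] : Prop where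
  finite_not_le : ∀ c : N, {x : N | ¬ c ≤ x}.Finite

/-- A family of nondegenerate intervals `[a, b]` that is closed under subintervals and under
merging two intervals neither of which lies strictly below the other one. -/
@[ext]
structure IntervalFamily (N : Type u) [Lattice N] : Type u where
  rel : N → N → Prop
  lt : ∀ {a b}, rel a b → a < b
  mono : ∀ {a b a' b'}, rel a b → a ≤ a' → a' < b' → b' ≤ b → rel a' b'
  merge : ∀ {a b a' b'}, rel a b → rel a' b' → ¬ b < a' → ¬ b' < a → rel (a ⊓ a') (b ⊔ b')

namespace IntervalFamily

variable {N : Type u} [Lattice N]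

instance : PartialOrder (IntervalFamily N) where
  le D E := ∀ a b, D.rel a b → E.rel a b
  le_refl _ _ _ h := h
  le_trans _ _ _ h₁ h₂ a b h := h₂ a b (h₁ a b h)
  le_antisymm D E h₁ h₂ := by
    ext a b
    exact ⟨h₁ a b, h₂ a b⟩

theorem le_def {D E : IntervalFamily N} : D ≤ E ↔ ∀ a b, D.rel a b → E.rel a b := Iff.rfl

instance : InfSet (IntervalFamily N) where
  sInf S :=
    { rel := fun a b => a < b ∧ ∀ D ∈ S, D.rel a b
      lt := fun h => h.1
      mono := fun h h₁ h₂ h₃ => ⟨h₂, fun D hD => D.mono (h.2 D hD) h₁ h₂ h₃⟩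
      merge := fun h h' h₁ h₂ => ⟨inf_le_left.trans_lt (h.1.trans_le le_sup_left),
        fun D hD => D.merge (h.2 D hD) (h'.2 D hD) h₁ h₂⟩ }

theorem sInf_rel {S : Set (IntervalFamily N)} {a b : N} :
    (sInf S).rel a b ↔ a < b ∧ ∀ D ∈ S, D.rel a b := Iff.rfl

instance : CompleteLattice (IntervalFamily N) :=
  completeLatticeOfInf _ fun _ =>
    ⟨fun D hD _ _ h => (sInf_rel.1 h).2 D hD,
      fun E hE a b h => sInf_rel.2 ⟨E.lt h, fun _ hD => hE hD a b h⟩⟩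

/-- The family of all subintervals of intervals `[a, b]` with `p a b`. -/
def interval (a b : N) : IntervalFamily N where
  rel u v := a ≤ u ∧ u < v ∧ v ≤ b
  lt h := h.2.1
  mono h h₁ h₂ h₃ := ⟨h.1.trans h₁, h₂, h₃.trans h.2.2⟩
  merge h h' _ _ := ⟨le_inf h.1 h'.1, inf_le_left.trans_lt (h.2.1.trans_le le_sup_left),
    sup_le h.2.2 h'.2.2⟩

theorem interval_le {D : IntervalFamily N} {a b : N} (h : a < b) :
    interval a b ≤ D ↔ D.rel a b :=
  ⟨fun H => H _ _ ⟨le_rfl, h, le_rfl⟩, fun H _ _ h => D.mono H h.1 h.2.1 h.2.2⟩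

theorem bot_rel {a b : N} : ¬ (⊥ : IntervalFamily N).rel a b := fun h =>
  bot_le (a := (⟨fun _ _ => False, False.elim, False.elim, False.elim⟩ : IntervalFamily N)) a b h

theorem top_rel {a b : N} : (⊤ : IntervalFamily N).rel a b ↔ a < b :=
  ⟨fun h => lt _ h, fun h => (interval_le h).1 le_top⟩

theorem eq_bot_iff_rel {D : IntervalFamily N} : D = ⊥ ↔ ∀ a b, ¬ D.rel a b :=
  ⟨fun h _ _ => h ▸ bot_rel, fun h => le_bot_iff.1 fun a b hab => (h a b hab).elim⟩

theorem inf_rel {D E : IntervalFamily N} {a b : N} :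
    (D ⊓ E).rel a b ↔ D.rel a b ∧ E.rel a b := by
  constructor
  · exact fun h => ⟨inf_le_left (b := E) a b h, inf_le_right (a := D) a b h⟩
  · rintro ⟨h₁, h₂⟩
    have h := D.lt h₁
    exact (interval_le h).1 (le_inf ((interval_le h).2 h₁) ((interval_le h).2 h₂))

/-- The union of a directed set of families is a family, since a merge involves only two intervals.
Hence it bounds the join, and one interval below the join already lies in a single member. -/
theorem isCompactElement_interval {a b : N} (h : a < b) :
    IsCompactElement (interval a b) := by
  intro S U hne hdir hU hle
  let W : IntervalFamily N :=
    { rel := fun u v => ∃ D ∈ S, D.rel u v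
      lt := fun ⟨D, _, h⟩ => D.lt h
      mono := fun ⟨D, hD, h⟩ h₁ h₂ h₃ => ⟨D, hD, D.mono h h₁ h₂ h₃⟩
      merge := fun ⟨D, hD, h⟩ ⟨D', hD', h'⟩ h₁ h₂ => by
        obtain ⟨E, hE, h₃, h₄⟩ := hdir D hD D' hD'
        exact ⟨E, hE, E.merge (h₃ _ _ h) (h₄ _ _ h') h₁ h₂⟩ }
  have hW : U ≤ W := hU.2 fun D hD a b h => ⟨D, hD, h⟩
  obtain ⟨D, hD, hr⟩ := hW _ _ ((interval_le h).1 hle)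
  exact ⟨D, hD, (interval_le h).2 hr⟩

instance : IsCompactlyGenerated (IntervalFamily N) where
  exists_sSup_eq D := by
    refine ⟨{E | ∃ a b, D.rel a b ∧ E = interval a b}, ?_, le_antisymm (sSup_le ?_) ?_⟩
    · rintro _ ⟨a, b, h, rfl⟩
      exact isCompactElement_interval (D.lt h)
    · rintro _ ⟨a, b, h, rfl⟩
      exact (interval_le (D.lt h)).2 h
    · exact fun a b h => (interval_le (D.lt h)).1 (le_sSup ⟨a, b, h, rfl⟩)

/-- The family of all intervals that do not overlap any interval of the given family. -/
def orth (D : IntervalFamily N) : IntervalFamily N where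
  rel a b := a < b ∧ ∀ c d, D.rel c d → b ≤ c ∨ d ≤ a
  lt h := h.1
  mono h h₁ h₂ h₃ := ⟨h₂, fun c d hcd => (h.2 c d hcd).imp h₃.trans fun h => h.trans h₁⟩
  merge {a b a' b'} h h' h₁ h₂ := by
    refine ⟨inf_le_left.trans_lt (h.1.trans_le le_sup_left), fun c d hcd => ?_⟩
    have hlt := D.lt hcd
    -- In the two mixed cases [c, d] sits between the two intervals, so they are strictly separated.
    rcases h.2 c d hcd with h₃ | h₃ <;> rcases h'.2 c d hcd with h₄ | h₄
    · exact Or.inl (sup_le h₃ h₄)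
    · exact (h₁ (h₃.trans_lt (hlt.trans_le h₄))).elim
    · exact (h₂ (h₄.trans_lt (hlt.trans_le h₃))).elim
    · exact Or.inr (le_inf h₃ h₄)

theorem orth_antitone {D E : IntervalFamily N} (h : D ≤ E) : E.orth ≤ D.orth :=
  fun _ _ hab => ⟨hab.1, fun c d hcd => hab.2 c d (h c d hcd)⟩

theorem le_orth_orth (D : IntervalFamily N) : D ≤ D.orth.orth :=
  fun a b hab => ⟨D.lt hab, fun _ _ hcd => (hcd.2 a b hab).symm⟩

theorem inf_orth (D : IntervalFamily N) : D ⊓ D.orth = ⊥ :=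
  eq_bot_iff_rel.2 fun a b h => by
    obtain ⟨h₁, h₂, h₃⟩ := inf_rel.1 h
    rcases h₃ a b h₁ with h | h <;> exact h.not_gt h₂

theorem not_orth_iff {D : IntervalFamily N} {a b : N} (h : a < b) :
    ¬ D.orth.rel a b ↔ ∃ c d, D.rel c d ∧ ¬ b ≤ c ∧ ¬ d ≤ a := by
  simp [orth, h, not_or]

/-- If `[g, b]` overlaps the family and so does every `[g, r]`, where `r > g` is the left end of
a member overlapping `[g, b]`, then some overlapping member does not start strictly above `g`. -/
theorem exists_rel_not_lt [WellFoundedLT N] (D : IntervalFamily N) {g b : N} (hgb : g < b)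
    (h₀ : ¬ D.orth.rel g b)
    (h : ∀ r s, D.rel r s → g < r → ¬ b ≤ r → ¬ D.orth.rel g r) :
    ∃ r s, D.rel r s ∧ ¬ b ≤ r ∧ ¬ s ≤ g ∧ ¬ g < r := by
  -- Choose a minimal left end p. If g < p, a member overlapping [g, p] has, or acquires by merging
  -- with [p, q], a smaller left end.
  obtain ⟨p, ⟨q, hpq, hbp, hqg⟩, hmin⟩ := wellFounded_lt.has_min
    {p | ∃ q, D.rel p q ∧ ¬ b ≤ p ∧ ¬ q ≤ g} ((not_orth_iff hgb).1 h₀)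
  by_cases hgp : g < p
  · obtain ⟨r, s, hrs, hpr, hsg⟩ := (not_orth_iff hgp).1 (h p q hpq hgp hbp)
    by_cases h₁ : s < p
    · exact (hmin r ⟨s, hrs, fun hbr => hbp (hbr.trans ((D.lt hrs).trans h₁).le), hsg⟩
        ((D.lt hrs).trans h₁)).elim
    by_cases h₂ : q < r
    · exact (hpr ((D.lt hpq).trans h₂).le).elim
    refine (hmin (r ⊓ p) ⟨s ⊔ q, D.merge hrs hpq h₁ h₂,
      fun h => hbp (h.trans inf_le_right), fun h => hsg (le_sup_left.trans h)⟩ ?_).elim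
    exact lt_of_le_of_ne inf_le_right fun h => hpr (inf_eq_right.1 h)
  · exact ⟨p, q, hpq, hbp, hqg, hgp⟩

/-! ### Maximal intervals -/

/-- `a` is the left end of a maximal interval of the family. -/
def IsLeftEnd (D : IntervalFamily N) (a : N) : Prop :=
  ∃ b, D.rel a b ∧ ∀ a', D.rel a' b → ¬ a' < a

theorem exists_isLeftEnd [WellFoundedLT N] {D : IntervalFamily N} {a b : N} (h : D.rel a b) :
    ∃ c ≤ a, D.IsLeftEnd c ∧ D.rel c b := by
  obtain ⟨c, ⟨hc, hca⟩, hmin⟩ := wellFounded_lt.has_min {c | D.rel c b ∧ c ≤ a} ⟨a, h, le_rfl⟩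
  exact ⟨c, hca, ⟨b, hc, fun a' ha' hlt => hmin a' ⟨ha', hlt.le.trans hca⟩ hlt⟩, hc⟩

theorem IsLeftEnd.le {D : IntervalFamily N} {a b r s : N} (ha : D.IsLeftEnd a) (hab : D.rel a b)
    (hrs : D.rel r s) (h₁ : ¬ b < r) (h₂ : ¬ s < a) : a ≤ r := by
  obtain ⟨b₀, hb₀, hmin⟩ := ha
  have h := D.merge hab hrs h₁ h₂
  -- The minimality of a is known only for the right end b₀, so the merged interval is merged with
  -- [a, b₀] and cut back to b₀.
  have h' := D.merge hb₀ h (fun h => h.not_ge (inf_le_left.trans (D.lt hb₀).le))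
    (fun h => h.not_ge ((D.lt hab).le.trans le_sup_left))
  have h'' := D.mono h' le_rfl (inf_le_left.trans_lt (D.lt hb₀)) le_sup_left
  have := hmin _ h''
  by_contra hle
  exact this (lt_of_le_of_ne inf_le_left fun h => hle ((inf_eq_left.1 h).trans inf_le_right))

theorem IsLeftEnd.merge {D : IntervalFamily N} {a b r s : N} (ha : D.IsLeftEnd a)
    (hab : D.rel a b) (hrs : D.rel r s) (h₁ : ¬ b < r) (h₂ : ¬ s < a) : D.rel a (b ⊔ s) := by
  have h := D.merge hab hrs h₁ h₂
  rwa [inf_eq_left.2 (ha.le hab hrs h₁ h₂)] at h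

theorem rel_sup {D : IntervalFamily N} {a b c : N} (hb : D.rel a b) (hc : D.rel a c) :
    D.rel a (b ⊔ c) := by
  simpa using D.merge hb hc (D.lt hb).le.not_gt (D.lt hc).le.not_gt

theorem exists_max_of_finite {D : IntervalFamily N} {a b : N} (h : D.rel a b)
    (hfin : {c | D.rel a c}.Finite) : ∃ m, D.rel a m ∧ ∀ c, D.rel a c → c ≤ m := by
  obtain ⟨m, hm⟩ := hfin.exists_maximal ⟨b, h⟩
  refine ⟨m, hm.1, fun c hc => ?_⟩
  exact le_sup_right.trans (hm.2 (rel_sup hm.1 hc) le_sup_left)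

/-! ### Orthomodularity -/

section Cofinite

variable [CofiniteAbove N]

theorem exists_ge_of_infinite {D : IntervalFamily N} {a : N}
    (hinf : {c | D.rel a c}.Infinite) (c : N) : ∃ b, D.rel a b ∧ c ≤ b := by
  by_contra! h
  exact hinf ((CofiniteAbove.finite_not_le c).subset fun x hx => h x hx)

variable [WellFoundedLT N]

/-- It suffices to treat [a, b] in E with a the left end of a maximal interval of E. As no
subinterval avoids D, `exists_rel_not_lt` at g = a yields a member of D overlapping [a, b] whose
left end must be a. If the right ends of members of D starting at a have a maximum m with b ≰ m, the
same argument at g = m yields a member that merges with [a, m] past m, a contradiction. If there are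
infinitely many right ends, one of them is above b. -/
theorem le_of_orth_inf_eq_bot {D E : IntervalFamily N} (hDE : D ≤ E) (h : D.orth ⊓ E = ⊥) :
    E ≤ D := by
  have hE : ∀ a b, E.rel a b → ¬ D.orth.rel a b := fun a b h₁ h₂ =>
    eq_bot_iff_rel.1 h a b (inf_rel.2 ⟨h₂, h₁⟩)
  suffices H : ∀ a b, E.IsLeftEnd a → E.rel a b → ∃ c ≥ b, D.rel a c by
    intro a b hab
    obtain ⟨c, hca, hc, hcb⟩ := exists_isLeftEnd hab
    obtain ⟨d, hd, hcd⟩ := H c b hc hcb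
    exact D.mono hcd hca (E.lt hab) hd
  intro a b ha hab
  have step : ∀ g b, a ≤ g → E.rel a b → g < b →
      ∃ r s, D.rel r s ∧ ¬ b ≤ r ∧ ¬ s ≤ g ∧ ¬ g < r ∧ a ≤ r := by
    intro g b hag hab hgb
    have hle : ∀ r s, D.rel r s → ¬ b ≤ r → ¬ s ≤ g → a ≤ r ∧ E.rel a (b ⊔ s) :=
      fun r s hrs h₁ h₂ => by
        have h₃ : ¬ b < r := fun h => h₁ h.le
        have h₄ : ¬ s < a := fun h => h₂ (h.le.trans hag)
        exact ⟨ha.le hab (hDE _ _ hrs) h₃ h₄, ha.merge hab (hDE _ _ hrs) h₃ h₄⟩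
    obtain ⟨r, s, hrs, h₁, h₂, h₃⟩ := D.exists_rel_not_lt hgb
      (hE _ _ (E.mono hab hag hgb le_rfl)) fun r s hrs hgr hbr =>
        hE _ _ (E.mono (hle r s hrs hbr fun h => (hgr.trans (D.lt hrs)).not_ge h).2 hag hgr
          ((D.lt hrs).le.trans le_sup_right))
    exact ⟨r, s, hrs, h₁, h₂, h₃, (hle r s hrs h₁ h₂).1⟩
  obtain ⟨r, s, hrs, -, -, h₁, h₂⟩ := step a b le_rfl hab (E.lt hab)
  obtain rfl : a = r := by
    by_contra hne
    exact h₁ (lt_of_le_of_ne h₂ hne)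
  by_cases hfin : {c | D.rel a c}.Finite
  · obtain ⟨m, hm, hmax⟩ := exists_max_of_finite hrs hfin
    by_cases hbm : b ≤ m
    · exact ⟨m, hbm, hm⟩
    have hlt : m < b ⊔ m := lt_of_le_of_ne le_sup_right fun h => hbm (h ▸ le_sup_left)
    obtain ⟨p, q, hpq, -, h₃, h₄, h₅⟩ := step m (b ⊔ m) (D.lt hm).le
      (rel_sup hab (hDE _ _ hm)) hlt
    have h := D.merge hm hpq h₄ fun h => h₃ (h.le.trans (D.lt hm).le)
    rw [inf_eq_left.2 h₅] at h
    exact (h₃ (le_sup_right.trans (hmax _ h))).elim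
  · obtain ⟨c, hc, hbc⟩ := exists_ge_of_infinite hfin b
    exact ⟨c, hbc, hc⟩

theorem orth_orth (D : IntervalFamily N) : D.orth.orth = D := by
  refine le_antisymm (le_of_orth_inf_eq_bot (le_orth_orth D) ?_) (le_orth_orth D)
  exact inf_orth D.orth

/-- With F the left-hand side, F.orth ⊓ E lies below D.orth ⊓ E ≤ F and below F.orth, so it is ⊥ and
the previous criterion applies to F ≤ E. -/
theorem sup_orth_inf {D E : IntervalFamily N} (h : D ≤ E) : D ⊔ (D.orth ⊓ E) = E := by
  have hle : D ⊔ (D.orth ⊓ E) ≤ E := sup_le h inf_le_right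
  refine le_antisymm hle (le_of_orth_inf_eq_bot hle (le_bot_iff.1 ?_))
  have h₁ := inf_orth (D ⊔ (D.orth ⊓ E))
  rw [← h₁]
  refine le_inf ?_ inf_le_left
  exact le_sup_of_le_right (inf_le_inf_right _ (orth_antitone le_sup_left))

theorem isOrthomodular_orth : IsOrthomodular (orth : IntervalFamily N → IntervalFamily N) where
  antitone _ _ := orth_antitone
  involutive := orth_orth
  isCompl D := by
    refine ⟨disjoint_iff.2 (inf_orth D), codisjoint_iff.2 ?_⟩
    simpa using sup_orth_inf (le_top (a := D))
  orthomodular _ _ := sup_orth_inf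

end Cofinite

end IntervalFamily

/-! ### Terms of admissible sequences -/

namespace KalmbachStar

section Terms

variable {L : Type u} [PartialOrder L]

theorem term_lt_term {x : KalmbachStar L} {k l : ℕ} {a b : L} (hkl : k < l)
    (ha : x.term k = some a) (hb : x.term l = some b) : a < b := by
  cases x with
  | fin s hs he =>
    obtain ⟨h₁, rfl⟩ := List.getElem?_eq_some_iff.1 ha
    obtain ⟨h₂, rfl⟩ := List.getElem?_eq_some_iff.1 hb
    exact List.pairwise_iff_getElem.1 hs _ _ _ _ hkl
  | inf s hs =>
    obtain rfl := Option.some.inj ha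
    obtain rfl := Option.some.inj hb
    exact hs hkl

theorem term_le_term {x : KalmbachStar L} {k l : ℕ} {a b : L} (hkl : k ≤ l)
    (ha : x.term k = some a) (hb : x.term l = some b) : a ≤ b := by
  rcases hkl.lt_or_eq with h | rfl
  · exact (term_lt_term h ha hb).le
  · exact (Option.some.inj (ha.symm.trans hb)).le

theorem exists_term_of_le {x : KalmbachStar L} {k l : ℕ} {b : L} (hkl : k ≤ l)
    (hb : x.term l = some b) : ∃ a, x.term k = some a := by
  cases x with
  | fin s hs he =>
    obtain ⟨h₂, rfl⟩ := List.getElem?_eq_some_iff.1 hb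
    exact ⟨_, List.getElem?_eq_getElem (hkl.trans_lt h₂)⟩
  | inf s hs => exact ⟨_, rfl⟩

theorem exists_term_odd {x : KalmbachStar L} {i : ℕ} {a : L} (ha : x.term (2 * i) = some a) :
    ∃ b, x.term (2 * i + 1) = some b := by
  cases x with
  | fin s hs he =>
    obtain ⟨h₂, rfl⟩ := List.getElem?_eq_some_iff.1 ha
    obtain ⟨n, hn⟩ := he
    exact ⟨_, List.getElem?_eq_getElem (by omega)⟩
  | inf s hs => exact ⟨_, rfl⟩

theorem ext_term {x y : KalmbachStar L} (h : ∀ k, x.term k = y.term k) : x = y := by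
  cases x with
  | fin s hs he =>
    cases y with
    | fin t ht he' =>
      obtain rfl : s = t := List.ext_getElem? h
      rfl
    | inf t ht =>
      have := h s.length
      simp [term] at this
  | inf s hs =>
    cases y with
    | fin t ht he' =>
      have := h t.length
      simp [term] at this
    | inf t ht =>
      obtain rfl : s = t := funext fun k => Option.some.inj (h k)
      rfl

/-- `[a, b]` is the interval of index `i` of the sequence. -/
def IsInterval (x : KalmbachStar L) (i : ℕ) (a b : L) : Prop :=
  x.term (2 * i) = some a ∧ x.term (2 * i + 1) = some b

theorem IsInterval.lt {x : KalmbachStar L} {i : ℕ} {a b : L} (h : x.IsInterval i a b) : a < b :=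
  term_lt_term (Nat.lt_succ_self _) h.1 h.2

theorem IsInterval.lt_of_lt {x : KalmbachStar L} {i j : ℕ} {a b c d : L}
    (h : x.IsInterval i a b) (h' : x.IsInterval j c d) (hij : i < j) : b < c :=
  term_lt_term (by omega) h.2 h'.1

theorem IsInterval.index_eq {x : KalmbachStar L} {i j : ℕ} {a b c d : L}
    (h : x.IsInterval i a b) (h' : x.IsInterval j c d) (h₁ : a < d) (h₂ : c < b) : i = j := by
  rcases lt_trichotomy i j with hij | hij | hij
  · exact ((h.lt_of_lt h' hij).asymm h₂).elim
  · exact hij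
  · exact ((h'.lt_of_lt h hij).asymm h₁).elim

theorem IsInterval.ends_eq {x : KalmbachStar L} {i : ℕ} {a b c d : L}
    (h : x.IsInterval i a b) (h' : x.IsInterval i c d) : a = c ∧ b = d :=
  ⟨Option.some.inj (h.1.symm.trans h'.1), Option.some.inj (h.2.symm.trans h'.2)⟩

theorem below_iff {x y : KalmbachStar L} : x.Below y ↔ ∀ i a b, x.IsInterval i a b →
    ∃ j c d, y.IsInterval j c d ∧ c ≤ a ∧ b ≤ d := by
  simp only [Below, IsInterval, and_imp, and_assoc]

theorem eq_of_forall_isInterval {x y : KalmbachStar L}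
    (h : ∀ i a b, x.IsInterval i a b ↔ y.IsInterval i a b) : x = y := by
  have key : ∀ x y : KalmbachStar L, (∀ i a b, x.IsInterval i a b → y.IsInterval i a b) →
      ∀ k a, x.term k = some a → y.term k = some a := by
    intro x y h k a ha
    obtain ⟨i, rfl | rfl⟩ := k.even_or_odd'
    · obtain ⟨b, hb⟩ := exists_term_odd ha
      exact (h i a b ⟨ha, hb⟩).1
    · obtain ⟨b, hb⟩ := exists_term_of_le (Nat.le_succ (2 * i)) ha
      exact (h i b a ⟨hb, ha⟩).2
  refine ext_term fun k => Option.ext fun a => ⟨?_, ?_⟩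
  · exact key x y (fun i a b => (h i a b).1) k a
  · exact key y x (fun i a b => (h i a b).2) k a

/-- Mutual containment makes the two sequences have the same intervals, since an interval of x can
only return into itself. Both list them in increasing order, so strong induction shows that the
indices agree. -/
theorem below_antisymm {x y : KalmbachStar L} (hxy : x.Below y) (hyx : y.Below x) : x = y := by
  have key : ∀ x y : KalmbachStar L, x.Below y → y.Below x → ∀ i a b, x.IsInterval i a b →
      ∃ j, y.IsInterval j a b := by
    intro x y hxy hyx i a b h
    obtain ⟨j, c, d, h', hca, hbd⟩ := below_iff.1 hxy i a b h
    obtain ⟨k, e, f, h'', hec, hdf⟩ := below_iff.1 hyx j c d h'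
    obtain rfl := h.index_eq h'' (h.lt.trans_le (hbd.trans hdf))
      ((hec.trans hca).trans_lt h.lt)
    obtain ⟨rfl, rfl⟩ := h.ends_eq h''
    obtain rfl := le_antisymm hca hec
    obtain rfl := le_antisymm hbd hdf
    exact ⟨j, h'⟩
  have key₂ : ∀ x y : KalmbachStar L, x.Below y → y.Below x → ∀ i,
      (∀ j < i, ∀ a b, y.IsInterval j a b → x.IsInterval j a b) → ∀ a b, x.IsInterval i a b →
      ∃ j ≥ i, y.IsInterval j a b := by
    intro x y hxy hyx i hi a b h
    obtain ⟨j, hj⟩ := key x y hxy hyx i a b h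
    refine ⟨j, not_lt.1 fun hji => ?_, hj⟩
    exact hji.ne ((hi j hji a b hj).index_eq h h.lt h.lt)
  refine eq_of_forall_isInterval fun i => ?_
  induction i using Nat.strong_induction_on with
  | _ i ih =>
    have key₃ : ∀ x y : KalmbachStar L, x.Below y → y.Below x →
      (∀ j < i, ∀ a b, x.IsInterval j a b ↔ y.IsInterval j a b) → ∀ a b, x.IsInterval i a b →
      y.IsInterval i a b := by
      intro x y hxy hyx ih a b h
      obtain ⟨j, hj, hy⟩ := key₂ x y hxy hyx i (fun j hj a b => (ih j hj a b).2) a b h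
      rcases eq_or_lt_of_le hj with rfl | hij
      · exact hy
      obtain ⟨c, hc⟩ := exists_term_of_le (show 2 * i ≤ 2 * j by omega) hy.1
      obtain ⟨d, hd⟩ := exists_term_odd hc
      obtain ⟨k, hk, hx⟩ := key₂ y x hyx hxy i (fun j hj a b => (ih j hj a b).1) c d ⟨hc, hd⟩
      have h₁ : d < a := IsInterval.lt_of_lt ⟨hc, hd⟩ hy hij
      have h₂ : a ≤ c := term_le_term (by omega) h.1 hx.1
      exact ((h₁.trans_le h₂).asymm (IsInterval.lt (i := i) ⟨hc, hd⟩)).elim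
    exact fun a b => ⟨key₃ x y hxy hyx ih a b,
      key₃ y x hyx hxy (fun j hj a b => (ih j hj a b).symm) a b⟩

/-- Interlacing sequences of left and right ends are the ends of an admissible sequence. -/
theorem exists_isInterval_iff (n : ℕ∞) (c d : ℕ → L) (h₁ : ∀ i : ℕ, (i : ℕ∞) < n → c i < d i)
    (h₂ : ∀ i : ℕ, ((i + 1 : ℕ) : ℕ∞) < n → d i < c (i + 1)) :
    ∃ x : KalmbachStar L, ∀ i a b, x.IsInterval i a b ↔ (i : ℕ∞) < n ∧ c i = a ∧ d i = b := by
  let s : ℕ → L := fun k => if k % 2 = 0 then c (k / 2) else d (k / 2)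
  have s₀ : ∀ i, s (2 * i) = c i := fun i => by simp [s]
  have s₁ : ∀ i, s (2 * i + 1) = d i := fun i => by
    have e₁ : (2 * i + 1) % 2 = 1 := by omega
    have e₂ : (2 * i + 1) / 2 = i := by omega
    simp [s, e₁, e₂]
  induction n using ENat.recTopCoe with
  | top =>
    refine ⟨inf s (strictMono_nat_of_lt_succ fun k => ?_), fun i a b => ?_⟩
    · obtain ⟨i, rfl | rfl⟩ := k.even_or_odd'
      · rw [s₀, s₁]
        exact h₁ i (ENat.natCast_lt_top i)
      · rw [s₁, show 2 * i + 1 + 1 = 2 * (i + 1) by ring, s₀]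
        exact h₂ i (ENat.natCast_lt_top _)
    · simp [IsInterval, term, s₀, s₁]
  | coe n =>
    refine ⟨fin ((List.range (2 * n)).map s) ?_ (by simp), fun i a b => ?_⟩
    · refine List.isChain_iff_pairwise.1 (List.isChain_iff_getElem.2 fun k hk => ?_)
      simp only [List.length_map, List.length_range] at hk
      simp only [List.getElem_map, List.getElem_range]
      obtain ⟨i, rfl | rfl⟩ := k.even_or_odd'
      · rw [s₀, s₁]
        exact h₁ i (by norm_cast; omega)
      · rw [s₁, show 2 * i + 1 + 1 = 2 * (i + 1) by ring, s₀]
        exact h₂ i (by norm_cast; omega)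
    · by_cases hi : i < n
      · have e : 2 * i + 1 < 2 * n := by omega
        simp [IsInterval, term, List.getElem?_range e, hi, s₀, s₁]
      · simp [IsInterval, term, hi]

end Terms

end KalmbachStar

/-! ### The interval family of an admissible sequence -/

namespace CofiniteAbove

variable {N : Type u} [PartialOrder N] [CofiniteAbove N] [NoMaxOrder N]

theorem finite_Iic (a : N) : (Set.Iic a).Finite := by
  obtain ⟨b, hb⟩ := exists_gt a
  exact (finite_not_le b).subset fun x hx h => (hb.trans_le h).not_ge hx

/-- The number of elements below a given one. -/
noncomputable def rank (a : N) : ℕ := (Set.Iic a).ncard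

theorem strictMono_rank : StrictMono (rank : N → ℕ) := fun _ b h =>
  Set.ncard_lt_ncard (Set.Iic_ssubset_Iic.2 h) (finite_Iic b)

instance : WellFoundedLT N := strictMono_rank.wellFoundedLT

end CofiniteAbove

namespace KalmbachStar

variable {N : Type u} [Lattice N]

/-- The family of all nondegenerate intervals contained in an interval of the sequence. -/
def family (x : KalmbachStar (WithTop N)) : IntervalFamily N where
  rel a b := a < b ∧ ∃ j c d, x.IsInterval j c d ∧ c ≤ a ∧ b ≤ d
  lt h := h.1
  mono := by
    rintro _ _ _ _ ⟨-, j, c, d, h, hca, hbd⟩ h₁ h₂ h₃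
    exact ⟨h₂, j, c, d, h, hca.trans (WithTop.coe_le_coe.2 h₁),
      (WithTop.coe_le_coe.2 h₃).trans hbd⟩
  merge := by
    rintro a b a' b' ⟨hab, j, c, d, h, hca, hbd⟩ ⟨-, j', c', d', h', hca', hbd'⟩ h₁ h₂
    refine ⟨inf_le_left.trans_lt (hab.trans_le le_sup_left), ?_⟩
    rcases lt_trichotomy j j' with hj | rfl | hj
    · refine (h₁ ?_).elim
      exact WithTop.coe_lt_coe.1 ((hbd.trans_lt (h.lt_of_lt h' hj)).trans_le hca')
    · obtain ⟨rfl, rfl⟩ := h.ends_eq h'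
      refine ⟨j, c, d, h, ?_, ?_⟩
      · rw [WithTop.coe_inf]
        exact le_inf hca hca'
      · rw [WithTop.coe_sup]
        exact sup_le hbd hbd'
    · refine (h₂ ?_).elim
      exact WithTop.coe_lt_coe.1 ((hbd'.trans_lt (h'.lt_of_lt h hj)).trans_le hca)

theorem family_zero : (zero (WithTop N)).family = ⊥ :=
  IntervalFamily.eq_bot_iff_rel.2 fun _ _ ⟨_, _, _, _, h, _⟩ => by
    simpa [zero, term] using h.1

theorem family_one [OrderBot N] [Nontrivial (WithTop N)] : (one (WithTop N)).family = ⊤ :=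
  top_le_iff.1 fun a b hab => by
    refine ⟨IntervalFamily.top_rel.1 hab, 0, ⊥, ⊤, ⟨rfl, rfl⟩, bot_le, le_top⟩

theorem IsInterval.exists_coe {x : KalmbachStar (WithTop N)} {i : ℕ} {a b : WithTop N}
    (h : x.IsInterval i a b) : ∃ c : N, a = c := by
  obtain ⟨c, hc⟩ := WithTop.ne_top_iff_exists.1 (h.lt.trans_le le_top).ne
  exact ⟨c, hc.symm⟩

theorem eq_top_of_forall_le [NoMaxOrder N] {a : N} {t : WithTop N}
    (h : ∀ b : N, a < b → (b : WithTop N) ≤ t) : t = ⊤ := by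
  induction t using WithTop.recTopCoe with
  | top => rfl
  | coe m =>
    obtain ⟨b, hb⟩ := exists_gt (a ⊔ m)
    exact ((le_sup_right.trans_lt hb).not_ge
      (WithTop.coe_le_coe.1 (h b (le_sup_left.trans_lt hb)))).elim

theorem below_iff_family_le [NoMaxOrder N] {x y : KalmbachStar (WithTop N)} :
    x.Below y ↔ x.family ≤ y.family := by
  constructor
  · rintro h a b ⟨hab, i, c, d, hi, hca, hbd⟩
    obtain ⟨j, e, f, hj, hec, hdf⟩ := below_iff.1 h i c d hi
    exact ⟨hab, j, e, f, hj, hec.trans hca, hbd.trans hdf⟩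
  · intro h
    refine below_iff.2 fun i a b hi => ?_
    obtain ⟨a, rfl⟩ := hi.exists_coe
    induction b using WithTop.recTopCoe with
    | coe b =>
      obtain ⟨-, h'⟩ := h a b ⟨WithTop.coe_lt_coe.1 hi.lt, i, a, b, hi, le_rfl, le_rfl⟩
      exact h'
    | top =>
      have key : ∀ b : N, a < b → ∃ j c d, y.IsInterval j c d ∧ c ≤ (a : WithTop N) ∧
        (b : WithTop N) ≤ d := fun b hb => (h a b ⟨hb, i, a, ⊤, hi, le_rfl, le_top⟩).2
      obtain ⟨b₀, hb₀⟩ := exists_gt a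
      obtain ⟨j, c, d, hj, hca, hbd⟩ := key b₀ hb₀
      -- The intervals of y containing the various [a, b] overlap, so they are one and the same; its
      -- right end bounds every b > a and must be ⊤.
      refine ⟨j, c, d, hj, hca, (eq_top_of_forall_le (a := a) fun b hb => ?_).ge⟩
      obtain ⟨k, e, f, hk, hea, hbf⟩ := key b hb
      obtain rfl := hj.index_eq hk (hca.trans_lt ((WithTop.coe_lt_coe.2 hb).trans_le hbf))
        (hea.trans_lt ((WithTop.coe_lt_coe.2 hb₀).trans_le hbd))
      obtain ⟨rfl, rfl⟩ := hj.ends_eq hk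
      exact hbf

theorem family_injective [NoMaxOrder N] :
    Function.Injective (family : KalmbachStar (WithTop N) → IntervalFamily N) := fun _ _ h =>
  below_antisymm (below_iff_family_le.2 h.le) (below_iff_family_le.2 h.ge)

/-- Admissible sequences ordered by inclusion of their interval families. -/
abbrev partialOrder [NoMaxOrder N] : PartialOrder (KalmbachStar (WithTop N)) :=
  PartialOrder.lift family family_injective

attribute [local instance] partialOrder

theorem le_iff_below [NoMaxOrder N] {x y : KalmbachStar (WithTop N)} : x ≤ y ↔ x.Below y :=
  below_iff_family_le.symm

end KalmbachStar

/-! ### Recovering a sequence from its interval family -/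

namespace IntervalFamily

variable {N : Type u} [Lattice N] [CofiniteAbove N]

open Classical in
/-- The right end of the maximal interval with left end `a`. -/
noncomputable def rightEnd (D : IntervalFamily N) (a : N) : WithTop N :=
  if h : ∃ m, D.rel a m ∧ ∀ b, D.rel a b → b ≤ m then (h.choose : N) else ⊤

/-- The value ⊤ is right when there is no largest right end: the right ends are then infinitely
many, and by cofiniteness some of them exceeds any given b. -/
theorem rel_iff_le_rightEnd {D : IntervalFamily N} {a b : N} (ha : D.IsLeftEnd a) :
    D.rel a b ↔ a < b ∧ (b : WithTop N) ≤ D.rightEnd a := by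
  obtain ⟨b₀, hb₀, -⟩ := ha
  unfold rightEnd
  split_ifs with h
  · rw [WithTop.coe_le_coe]
    exact ⟨fun hab => ⟨D.lt hab, h.choose_spec.2 b hab⟩,
      fun hab => D.mono h.choose_spec.1 le_rfl hab.1 hab.2⟩
  · refine ⟨fun hab => ⟨D.lt hab, le_top⟩, fun hab => ?_⟩
    obtain ⟨c, hc, hbc⟩ := exists_ge_of_infinite (fun hf => h (exists_max_of_finite hb₀ hf)) b
    exact D.mono hc le_rfl hab.1 hbc

theorem IsLeftEnd.lt_rightEnd {D : IntervalFamily N} {a : N} (ha : D.IsLeftEnd a) :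
    (a : WithTop N) < D.rightEnd a := by
  have h := ha
  obtain ⟨b, hab, -⟩ := h
  exact (WithTop.coe_lt_coe.2 (D.lt hab)).trans_le ((rel_iff_le_rightEnd ha).1 hab).2

variable [NoMaxOrder N]

/-- Otherwise the two intervals are not strictly separated, so each left end is below the other and
the ranks coincide. -/
theorem IsLeftEnd.lt_of_rank_lt {D : IntervalFamily N} {a a' b : N} (ha : D.IsLeftEnd a)
    (ha' : D.IsLeftEnd a') (h : CofiniteAbove.rank a < CofiniteAbove.rank a')
    (hab : D.rel a b) : b < a' := by
  have hb' := ha'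
  obtain ⟨b', hb', -⟩ := hb'
  by_contra h₁
  have h₂ : ¬ b' < a := fun h₂ =>
    (CofiniteAbove.strictMono_rank ((D.lt hb').trans h₂)).not_gt h
  exact h.ne (congrArg _ (le_antisymm (ha.le hab hb' h₁ h₂) (ha'.le hb' hab h₂ h₁)))

theorem IsLeftEnd.rightEnd_lt {D : IntervalFamily N} {a a' : N} (ha : D.IsLeftEnd a)
    (ha' : D.IsLeftEnd a') (h : CofiniteAbove.rank a < CofiniteAbove.rank a') :
    D.rightEnd a < a' := by
  have hlt : ∀ b, D.rel a b → b < a' := fun b hab => ha.lt_of_rank_lt ha' h hab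
  have hb := ha
  obtain ⟨b, hab, -⟩ := hb
  have hex := exists_max_of_finite hab
    ((CofiniteAbove.finite_Iic a').subset fun c hc => (hlt c hc).le)
  rw [rightEnd, dif_pos hex]
  exact WithTop.coe_lt_coe.2 (hlt _ hex.choose_spec.1)

end IntervalFamily

namespace KalmbachStar

variable {N : Type u} [Lattice N] [CofiniteAbove N] [NoMaxOrder N]

-- Distinct left ends of maximal intervals have distinct ranks, and increasing rank puts the
-- intervals in increasing order. Enumerating the left ends by rank, finitely or infinitely many,
-- gives the sequence.
open IntervalFamily CofiniteAbove in
theorem family_surjective :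
    Function.Surjective (family : KalmbachStar (WithTop N) → IntervalFamily N) := by
  classical
  intro D
  let p : ℕ → Prop := fun r => ∃ a, D.IsLeftEnd a ∧ rank a = r
  let n : ℕ∞ := if hf : (Set.ofPred p).Finite then (hf.toFinset.card : ℕ∞) else ⊤
  have hn : ∀ i : ℕ, (i : ℕ∞) < n ↔ ∀ hf : (Set.ofPred p).Finite, i < hf.toFinset.card := by
    intro i
    by_cases hf : (Set.ofPred p).Finite
    · simp only [n, dif_pos hf, Nat.cast_lt]
      exact ⟨fun h _ => h, fun h => h hf⟩
    · simp [n, hf]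
  rcases isEmpty_or_nonempty N with hN | hN
  · refine ⟨zero _, ?_⟩
    ext a
    exact hN.elim a
  -- For i ≥ n the value is arbitrary and never used.
  have hc : ∀ i : ℕ, ∃ a, (i : ℕ∞) < n → D.IsLeftEnd a ∧ rank a = Nat.nth p i := by
    intro i
    by_cases hi : (i : ℕ∞) < n
    · obtain ⟨a, ha⟩ := Nat.nth_mem i ((hn i).1 hi)
      exact ⟨a, fun _ => ha⟩
    · exact ⟨hN.some, fun h => (hi h).elim⟩
  choose c hc using hc
  obtain ⟨x, hx⟩ := exists_isInterval_iff n (fun i => (c i : WithTop N))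
    (fun i => D.rightEnd (c i)) (fun i hi => (hc i hi).1.lt_rightEnd) (fun i hi => by
      have hi' : (i : ℕ∞) < n := lt_trans (by exact_mod_cast Nat.lt_succ_self i) hi
      refine (hc i hi').1.rightEnd_lt (hc _ hi).1 ?_
      rw [(hc i hi').2, (hc _ hi).2]
      exact Nat.nth_lt_nth' (Nat.lt_succ_self i) ((hn _).1 hi))
  refine ⟨x, ?_⟩
  ext a b
  constructor
  · rintro ⟨hab, j, e, f, hj, hea, hbf⟩
    obtain ⟨hjn, rfl, rfl⟩ := (hx _ _ _).1 hj
    have hca := WithTop.coe_le_coe.1 hea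
    exact D.mono ((rel_iff_le_rightEnd (hc j hjn).1).2 ⟨hca.trans_lt hab, hbf⟩) hca hab le_rfl
  · intro hab
    obtain ⟨a₀, ha₀, hl, hr⟩ := exists_isLeftEnd hab
    obtain ⟨j, hj, hj'⟩ := Nat.exists_lt_card_nth_eq (p := p) ⟨a₀, hl, rfl⟩
    have hjn := (hn j).2 hj
    obtain ⟨hl', hr'⟩ := hc j hjn
    have hrk := hr'.trans hj'
    have e : c j = a₀ := by
      obtain ⟨b', hb', -⟩ := id hl'
      have h₁ : ¬ b' < a₀ := fun h => (strictMono_rank ((D.lt hb').trans h)).ne hrk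
      have h₂ : ¬ b < c j := fun h => (strictMono_rank ((D.lt hr).trans h)).ne hrk.symm
      exact le_antisymm (hl'.le hb' hr h₁ h₂) (hl.le hr hb' h₂ h₁)
    refine ⟨D.lt hab, j, c j, D.rightEnd (c j), (hx _ _ _).2 ⟨hjn, rfl, rfl⟩, ?_, ?_⟩
    · exact WithTop.coe_le_coe.2 (e ▸ ha₀)
    · exact ((rel_iff_le_rightEnd hl').1 (e ▸ hr)).2

end KalmbachStar

/-! ### The orthocomplement of an admissible sequence -/

theorem mem_toggleBot {L : Type u} [PartialOrder L] [BoundedOrder L] {s : List L} {t : L} :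
    t ∈ toggleBot s ↔ (t ∈ s ↔ t ≠ ⊥) := by
  classical
  unfold toggleBot
  split_ifs with h
  · by_cases ht : t = ⊥ <;> simp [ht, h]
  · by_cases ht : t = ⊥ <;> simp [ht, h]

theorem mem_toggleTop {L : Type u} [PartialOrder L] [BoundedOrder L] {s : List L} {t : L} :
    t ∈ toggleTop s ↔ (t ∈ s ↔ t ≠ ⊤) := by
  classical
  unfold toggleTop
  split_ifs with h
  · by_cases ht : t = ⊤ <;> simp [ht, h]
  · by_cases ht : t = ⊤ <;> simp [ht, h]

namespace KalmbachStar

section Support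

variable {L : Type u} [PartialOrder L]

/-- The set of terms of a sequence. -/
def support (x : KalmbachStar L) : Set L := {t | ∃ k, x.term k = some t}

theorem support_fin {s : List L} {hs he} : (fin s hs he).support = {t | t ∈ s} := by
  ext t
  simp [support, term, List.mem_iff_getElem?]

theorem mem_support_inf {s : ℕ → L} {hs} {t : L} : t ∈ (inf s hs).support ↔ ∃ k, s k = t := by
  simp [support, term]

/-- Away from ⊤ the finite and infinite cases of `perp` agree: only ⊥ is toggled. -/
theorem mem_support_perp [BoundedOrder L] {x : KalmbachStar L} {t : L} (ht : t ≠ ⊤) :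
    t ∈ x.perp.support ↔ (t ∈ x.support ↔ t ≠ ⊥) := by
  cases x with
  | fin s hs he =>
    simp [perp, support_fin, mem_toggleTop, mem_toggleBot, ht]
  | inf s hs =>
    simp only [perp]
    split_ifs with h
    · refine mem_support_inf.trans ?_
      rw [mem_support_inf]
      constructor
      · rintro ⟨k, rfl⟩
        have : s 0 < s (k + 1) := hs (Nat.succ_pos k)
        exact ⟨fun _ => (bot_le.trans_lt this).ne', fun _ => ⟨_, rfl⟩⟩
      · intro h'
        have hne : t ≠ ⊥ := fun e => h'.1 ⟨0, h.trans e.symm⟩ e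
        obtain ⟨k, rfl⟩ := h'.2 hne
        cases k with
        | zero => exact (hne h).elim
        | succ k => exact ⟨k, rfl⟩
    · refine mem_support_inf.trans ?_
      rw [mem_support_inf]
      have h₀ : ∀ k, s k ≠ ⊥ := fun k e =>
        h (le_bot_iff.1 ((hs.monotone (Nat.zero_le k)).trans e.le))
      constructor
      · rintro ⟨k, rfl⟩
        cases k with
        | zero => exact ⟨fun ⟨k, hk⟩ => (h₀ k hk).elim, fun h => (h rfl).elim⟩
        | succ k => exact ⟨fun _ => h₀ k, fun _ => ⟨k, rfl⟩⟩
      · intro h'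
        by_cases e : t = ⊥
        · exact ⟨0, e.symm⟩
        · obtain ⟨k, rfl⟩ := h'.2 e
          exact ⟨k + 1, rfl⟩

theorem ncard_support_le {x : KalmbachStar L} {a : L} {j : ℕ}
    (h : ∀ l t, x.term l = some t → t ≤ a → l < j) : {t ∈ x.support | t ≤ a}.ncard ≤ j := by
  -- The default a for missing terms can only enlarge the image, which is harmless for an upper
  -- bound.
  have hsub : {t ∈ x.support | t ≤ a} ⊆ (fun k => (x.term k).getD a) '' Set.Iio j := by
    rintro t ⟨⟨k, hk⟩, hta⟩
    exact ⟨k, h k t hk hta, by simp [hk]⟩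
  refine (Set.ncard_le_ncard hsub ((Set.finite_Iio j).image _)).trans ?_
  refine (Set.ncard_image_le (Set.finite_Iio j)).trans ?_
  simp [Set.ncard_eq_toFinset_card']

theorem le_iff_lt_ncard_support {x : KalmbachStar L} {a : L}
    (hfin : {t ∈ x.support | t ≤ a}.Finite) {k : ℕ} {t : L} (hk : x.term k = some t) :
    t ≤ a ↔ k < {t ∈ x.support | t ≤ a}.ncard := by
  constructor
  · intro hta
    have hsub : (fun k => (x.term k).getD a) '' Set.Iio (k + 1) ⊆ {t ∈ x.support | t ≤ a} := by
      rintro _ ⟨l, hl, rfl⟩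
      have hlk := Nat.lt_succ_iff.1 hl
      obtain ⟨b, hb⟩ := exists_term_of_le hlk hk
      simp only [hb, Option.getD_some]
      exact ⟨⟨l, hb⟩, (term_le_term hlk hb hk).trans hta⟩
    have hinj : Set.InjOn (fun k => (x.term k).getD a) (Set.Iio (k + 1)) := by
      intro l hl m hm hlm
      obtain ⟨b, hb⟩ := exists_term_of_le (Nat.lt_succ_iff.1 hl) hk
      obtain ⟨c, hc⟩ := exists_term_of_le (Nat.lt_succ_iff.1 hm) hk
      simp only [hb, hc, Option.getD_some] at hlm
      subst hlm
      rcases lt_trichotomy l m with h | h | h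
      · exact ((term_lt_term h hb hc).false).elim
      · exact h
      · exact ((term_lt_term h hc hb).false).elim
    have := Set.ncard_le_ncard hsub hfin
    rw [hinj.ncard_image] at this
    simpa [Set.ncard_eq_toFinset_card', Nat.succ_le_iff] using this
  · intro h
    by_contra hta
    refine h.not_ge (ncard_support_le fun l u hl hua => ?_)
    by_contra hlk
    exact hta ((term_le_term (not_lt.1 hlk) hk hl).trans hua)

end Support

variable {N : Type u} [Lattice N] [CofiniteAbove N] [NoMaxOrder N]

theorem finite_support_le (x : KalmbachStar (WithTop N)) (a : N) :
    {t ∈ x.support | t ≤ (a : WithTop N)}.Finite := by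
  refine ((CofiniteAbove.finite_Iic a).image ((↑) : N → WithTop N)).subset ?_
  rintro t ⟨-, ht⟩
  obtain ⟨b, rfl, hb⟩ := WithTop.le_coe_iff.1 ht
  exact ⟨b, WithTop.coe_le_coe.1 ht, rfl⟩

/-- If no term separates a from b, then [a, b] lies inside an interval of the sequence or in a gap,
according to whether the number of terms ≤ a is odd or even. -/
theorem family_rel_iff {x : KalmbachStar (WithTop N)} {a b : N} : x.family.rel a b ↔
    a < b ∧ (∀ t ∈ x.support, t ≤ (a : WithTop N) ∨ (b : WithTop N) ≤ t) ∧
      Odd {t ∈ x.support | t ≤ (a : WithTop N)}.ncard := by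
  have key := fun k t hk => le_iff_lt_ncard_support (finite_support_le x a) (k := k) (t := t) hk
  constructor
  · rintro ⟨hab, j, c, d, hj, hca, hbd⟩
    refine ⟨hab, ?_, ?_⟩
    · rintro t ⟨k, hk⟩
      rcases Nat.lt_or_ge (2 * j) k with h | h
      · exact Or.inr (hbd.trans (term_le_term h hj.2 hk))
      · exact Or.inl ((term_le_term h hk hj.1).trans hca)
    · have h₁ := (key _ _ hj.1).1 hca
      have h₂ := mt (key _ _ hj.2).2 fun h =>
        (WithTop.coe_lt_coe.2 hab).not_ge (hbd.trans h)
      exact ⟨j, by omega⟩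
  · rintro ⟨hab, hcmp, j, hj⟩
    obtain ⟨c, hc⟩ : ∃ c, x.term (2 * j) = some c := by
      by_contra hnone
      have := ncard_support_le (x := x) (a := (a : WithTop N)) (j := 2 * j)
        fun l t hl _ => not_le.1 fun h => hnone (exists_term_of_le h hl)
      omega
    obtain ⟨d, hd⟩ := exists_term_odd hc
    refine ⟨hab, j, c, d, ⟨hc, hd⟩, (key _ _ hc).2 (by omega), ?_⟩
    exact (hcmp d ⟨_, hd⟩).resolve_left fun h => by
      have := (key _ _ hd).1 h
      omega

theorem orth_family_rel_iff {x : KalmbachStar (WithTop N)} {a b : N} : x.family.orth.rel a b ↔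
    a < b ∧ (∀ t ∈ x.support, t ≤ (a : WithTop N) ∨ (b : WithTop N) ≤ t) ∧
      ¬ Odd {t ∈ x.support | t ≤ (a : WithTop N)}.ncard := by
  constructor
  · rintro ⟨hab, h⟩
    have hint : ∀ j c d, x.IsInterval j c d → (b : WithTop N) ≤ c ∨ d ≤ (a : WithTop N) := by
      intro j c d hj
      obtain ⟨c, rfl⟩ := hj.exists_coe
      induction d using WithTop.recTopCoe with
      | coe d =>
        have hcd := WithTop.coe_lt_coe.1 hj.lt
        exact (h c d ⟨hcd, j, c, d, hj, le_rfl, le_rfl⟩).imp WithTop.coe_le_coe.2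
          WithTop.coe_le_coe.2
      | top =>
        -- Families contain only intervals of `N`, so [c, ⊤] is tested through a finite d too large
        -- for d ≤ a.
        obtain ⟨d, hd⟩ := exists_gt (c ⊔ a)
        left
        refine WithTop.coe_le_coe.2 ((h c d ⟨le_sup_left.trans_lt hd, j, c, ⊤, hj, le_rfl,
          le_top⟩).resolve_right ?_)
        exact (le_sup_right.trans_lt hd).not_ge
    have hcmp : ∀ t ∈ x.support, t ≤ (a : WithTop N) ∨ (b : WithTop N) ≤ t := by
      rintro t ⟨k, hk⟩
      obtain ⟨i, rfl | rfl⟩ := k.even_or_odd'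
      · obtain ⟨d, hd⟩ := exists_term_odd hk
        have hi : x.IsInterval i t d := ⟨hk, hd⟩
        exact (hint i t d hi).symm.imp hi.lt.le.trans id
      · obtain ⟨c, hc⟩ := exists_term_of_le (Nat.le_succ (2 * i)) hk
        have hi : x.IsInterval i c t := ⟨hc, hk⟩
        exact (hint i c t hi).symm.imp id fun h => h.trans hi.lt.le
    refine ⟨hab, hcmp, fun hodd => ?_⟩
    rcases h a b (family_rel_iff.2 ⟨hab, hcmp, hodd⟩) with h | h <;> exact h.not_gt hab
  · rintro ⟨hab, hcmp, hodd⟩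
    refine ⟨hab, ?_⟩
    rintro c d ⟨hcd, j, e, f, hj, hec, hdf⟩
    rcases hcmp f ⟨_, hj.2⟩ with hf | hf
    · exact Or.inr (WithTop.coe_le_coe.1 (hdf.trans hf))
    rcases hcmp e ⟨_, hj.1⟩ with he | he
    · exact (hodd (family_rel_iff.1 ⟨hab, j, e, f, hj, he, hf⟩).2.2).elim
    · exact Or.inl (WithTop.coe_le_coe.1 (he.trans hec))

theorem odd_ncard_support_perp [OrderBot N] (x : KalmbachStar (WithTop N)) (a : N) :
    Odd {t ∈ x.perp.support | t ≤ (a : WithTop N)}.ncard ↔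
      ¬ Odd {t ∈ x.support | t ≤ (a : WithTop N)}.ncard := by
  have htop : ∀ t : WithTop N, t ≤ (a : WithTop N) → t ≠ ⊤ := fun t ht =>
    (ht.trans_lt (WithTop.coe_lt_top a)).ne
  have hfin := finite_support_le x a
  have hfin' := finite_support_le x.perp a
  by_cases h : ⊥ ∈ x.support
  · have e : {t ∈ x.support | t ≤ (a : WithTop N)} =
        insert ⊥ {t ∈ x.perp.support | t ≤ (a : WithTop N)} := by
      ext t
      by_cases ht : t = ⊥
      · simp [ht, h]
      · simp only [Set.mem_insert_iff, ht, false_or, Set.mem_sep_iff, and_congr_left_iff]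
        intro hta
        simp [mem_support_perp (htop t hta), ht]
    rw [e, Set.ncard_insert_of_notMem _ hfin', Nat.odd_add_one, not_not]
    rintro ⟨h', -⟩
    exact ((mem_support_perp bot_ne_top).1 h').1 h rfl
  · have e : {t ∈ x.perp.support | t ≤ (a : WithTop N)} =
        insert ⊥ {t ∈ x.support | t ≤ (a : WithTop N)} := by
      ext t
      by_cases ht : t = ⊥
      · simp [ht, h, mem_support_perp]
      · simp only [Set.mem_insert_iff, ht, false_or, Set.mem_sep_iff, and_congr_left_iff]
        intro hta
        simp [mem_support_perp (htop t hta), ht]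
    rw [e, Set.ncard_insert_of_notMem (fun h' => h h'.1) hfin, Nat.odd_add_one]

/-- Terms ⊥ and ⊤ never separate a from b, so toggling them affects only the parity, and there only
⊥ counts. -/
theorem family_perp [OrderBot N] (x : KalmbachStar (WithTop N)) :
    x.perp.family = x.family.orth := by
  ext a b
  rw [family_rel_iff, orth_family_rel_iff, odd_ncard_support_perp]
  refine and_congr_right fun hab => and_congr_left fun _ => forall_congr' fun t => ?_
  by_cases h₁ : t = ⊤
  · simp [h₁]
  by_cases h₂ : t = ⊥
  · simp [h₂]
  · simp [mem_support_perp h₁, h₂]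

attribute [local instance] partialOrder

/-- The order isomorphism between admissible sequences and interval families. -/
noncomputable def familyIso : KalmbachStar (WithTop N) ≃o IntervalFamily N where
  toEquiv := Equiv.ofBijective family ⟨family_injective, family_surjective⟩
  map_rel_iff' := Iff.rfl

/-- The complete lattice of admissible sequences. -/
noncomputable abbrev completeLattice : CompleteLattice (KalmbachStar (WithTop N)) :=
  (familyIso (N := N)).symm.toGaloisInsertion.liftCompleteLattice

theorem familyIso_perp [OrderBot N] (x : KalmbachStar (WithTop N)) :
    familyIso x.perp = (familyIso x).orth := family_perp x

end KalmbachStar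

/-! ### Transport along order isomorphisms -/

section Transport

variable {α β : Type u}

theorem HeightAtMost.of_orderEmbedding [PartialOrder α] [PartialOrder β] {n : ℕ}
    (h : HeightAtMost β n) (f : α ↪o β) : HeightAtMost α n := by
  intro s hs
  rw [← f.injective.encard_image s]
  refine h _ ?_
  rintro _ ⟨a, ha, rfl⟩ _ ⟨b, hb, rfl⟩ -
  exact (hs.total ha hb).imp (fun h => f.monotone h) fun h => f.monotone h

theorem HasFiniteHeight.of_orderEmbedding [PartialOrder α] [PartialOrder β]
    (h : HasFiniteHeight β) (f : α ↪o β) : HasFiniteHeight α :=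
  h.imp fun _ h => h.of_orderEmbedding f

theorem not_hasFiniteHeight_of_strictMono [PartialOrder α] {f : ℕ → α} (hf : StrictMono f) :
    ¬ HasFiniteHeight α := by
  rintro ⟨n, hn⟩
  have h := hn (Set.range f) hf.monotone.isChain_range
  rw [(Set.infinite_range_of_injective hf.injective).encard_eq, top_le_iff] at h
  exact (by norm_cast : ((n : ℕ∞) + 1) ≠ ⊤) h

theorem HasCoveringProperty.of_orderIso [Lattice α] [BoundedOrder α] [Lattice β] [BoundedOrder β]
    {n : ℕ} (h : HasCoveringProperty β n) (e : α ≃o β) : HasCoveringProperty α n := by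
  refine ⟨e.isAtomic_iff.2 h.1, fun a x ha => ?_⟩
  refine (h.2 (e a) (e x) ((e.isAtom_iff a).2 ha)).of_orderEmbedding
    (OrderEmbedding.ofMapLEIff (fun y => ⟨e y, e.monotone y.2.1, ?_⟩) fun y z => ?_)
  · exact (e.monotone y.2.2).trans (e.map_sup x a).le
  · exact e.le_iff_le

theorem IsCompactlyGenerated.of_orderIso [CompleteLattice α] [CompleteLattice β]
    [IsCompactlyGenerated β] (e : α ≃o β) : IsCompactlyGenerated α where
  exists_sSup_eq x := by
    obtain ⟨S, hS, hx⟩ := IsCompactlyGenerated.exists_sSup_eq (e x)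
    refine ⟨e ⁻¹' S, fun y hy T u hne hdir hu hle => ?_, ?_⟩
    · obtain ⟨_, ⟨z, hz, rfl⟩, hyz⟩ := hS _ hy (e '' T) (e u) (hne.image e)
        (by
          rintro _ ⟨a, ha, rfl⟩ _ ⟨b, hb, rfl⟩
          obtain ⟨c, hc, hac, hbc⟩ := hdir a ha b hb
          exact ⟨e c, ⟨c, hc, rfl⟩, e.monotone hac, e.monotone hbc⟩)
        (e.isLUB_image'.2 hu) (e.monotone hle)
      exact ⟨z, hz, e.le_iff_le.1 hyz⟩
    · apply e.injective
      rw [e.map_sSup, ← sSup_image, Set.image_preimage_eq _ e.surjective, hx]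

theorem IsOrthomodular.of_orderIso [Lattice α] [BoundedOrder α] [Lattice β] [BoundedOrder β]
    {p : α → α} {q : β → β} (h : IsOrthomodular q) (e : α ≃o β) (hpq : ∀ x, e (p x) = q (e x)) :
    IsOrthomodular p where
  antitone x y hxy := by
    rw [← e.le_iff_le, hpq, hpq]
    exact h.antitone _ _ (e.monotone hxy)
  involutive x := e.injective (by rw [hpq, hpq, h.involutive])
  isCompl x := by
    rw [e.isCompl_iff, hpq]
    exact h.isCompl _
  orthomodular x y hxy := e.injective (by
    rw [e.map_sup, e.map_inf, hpq]
    exact h.orthomodular _ _ (e.monotone hxy))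

theorem IsDirectlyIrreducible.of_orderIso [Lattice α] [BoundedOrder α] [Lattice β]
    [BoundedOrder β] {p : α → α} {q : β → β} (h : IsDirectlyIrreducible q) (e : α ≃o β)
    (hpq : ∀ x, e (p x) = q (e x)) : IsDirectlyIrreducible p := by
  refine ⟨e.toEquiv.nontrivial_congr.2 h.1, ?_⟩
  intro γ δ _ _ _ _ pγ pδ hγ hδ f hf
  refine h.2 γ δ pγ pδ hγ hδ (e.symm.trans f) fun x => ?_
  have hx : e.symm (q x) = p (e.symm x) := by
    apply e.injective
    rw [hpq, e.apply_symm_apply, e.apply_symm_apply]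
  simp only [OrderIso.trans_apply, hx, hf]

theorem IsOrthomodular.map_top [Lattice α] [BoundedOrder α] {p : α → α} (h : IsOrthomodular p) :
    p ⊤ = ⊥ :=
  top_disjoint.1 (h.isCompl ⊤).disjoint

theorem IsOrthomodular.map_bot [Lattice α] [BoundedOrder α] {p : α → α} (h : IsOrthomodular p) :
    p ⊥ = ⊤ :=
  codisjoint_bot.1 (h.isCompl ⊥).codisjoint.symm

end Transport

theorem IsChain.exists_strictMono_of_le_encard {α : Type u} [PartialOrder α] {s : Set α}
    (hs : IsChain (· ≤ ·) s) {n : ℕ} (h : (n : ℕ∞) ≤ s.encard) :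
    ∃ f : Fin n → α, StrictMono f ∧ ∀ i, f i ∈ s := by
  classical
  obtain ⟨t, hts, ht⟩ := Set.exists_subset_encard_eq h
  have hfin : t.Finite := Set.finite_of_encard_eq_coe ht
  let _ := hfin.fintype
  let _ := (hs.mono hts).linearOrder
  have hcard : Fintype.card t = n := by
    rw [Set.encard_eq_coe_toFinset_card, Set.toFinset_card] at ht
    exact_mod_cast ht
  let f := Fintype.orderIsoFinOfCardEq t hcard
  exact ⟨fun i => f i, fun i j hij => f.strictMono hij, fun i => hts (f i).2⟩

/-! ### Atoms and joins with atoms -/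

namespace IntervalFamily

variable {N : Type u} [Lattice N]

theorem strictMono_interval_bot [OrderBot N] : StrictMono (interval (⊥ : N)) := fun a b hab => by
  refine lt_of_le_not_ge (fun u v h => ⟨h.1, h.2.1, h.2.2.trans hab.le⟩) fun h => ?_
  exact (h a b ⟨bot_le, hab, le_rfl⟩).2.2.not_gt hab

theorem exists_covBy_rel [WellFoundedLT N] {D : IntervalFamily N} {a b : N} (h : D.rel a b) :
    ∃ c, a ⋖ c ∧ c ≤ b ∧ D.rel a c := by
  obtain ⟨c, hac, hcb⟩ := exists_covBy_le_of_lt (D.lt h)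
  exact ⟨c, hac, hcb, D.mono h le_rfl hac.lt hcb⟩

theorem isAtom_interval {c d : N} (h : c ⋖ d) : IsAtom (interval c d) := by
  refine ⟨fun hbot => eq_bot_iff_rel.1 hbot c d ⟨le_rfl, h.lt, le_rfl⟩, fun D hD => ?_⟩
  refine eq_bot_iff_rel.2 fun a b hab => hD.not_ge ?_
  obtain ⟨h₁, h₂, h₃⟩ := hD.le _ _ hab
  rcases h.eq_or_eq h₁ (h₂.le.trans h₃) with rfl | rfl
  · rcases h.eq_or_eq h₂.le h₃ with rfl | rfl
    · exact (lt_irrefl _ h₂).elim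
    · exact (interval_le h.lt).2 hab
  · exact (h₂.not_ge h₃).elim

theorem exists_interval_le [WellFoundedLT N] {D : IntervalFamily N} (hD : D ≠ ⊥) :
    ∃ c d, c ⋖ d ∧ interval c d ≤ D := by
  by_contra! h
  refine hD (eq_bot_iff_rel.2 fun a b hab => ?_)
  obtain ⟨c, hac, -, hc⟩ := exists_covBy_rel hab
  exact h a c hac ((interval_le hac.lt).2 hc)

instance [WellFoundedLT N] : IsAtomic (IntervalFamily N) where
  eq_bot_or_exists_atom_le D := by
    refine or_iff_not_imp_left.2 fun hD => ?_
    obtain ⟨c, d, hcd, h⟩ := exists_interval_le hD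
    exact ⟨_, isAtom_interval hcd, h⟩

theorem exists_eq_interval [WellFoundedLT N] {A : IntervalFamily N} (hA : IsAtom A) :
    ∃ c d, c ⋖ d ∧ A = interval c d := by
  obtain ⟨c, d, hcd, h⟩ := exists_interval_le hA.1
  exact ⟨c, d, hcd, ((hA.le_iff.1 h).resolve_left (isAtom_interval hcd).1).symm⟩

/-- Every subinterval of a member of `D.orth ⊓ (D ⊔ interval c d)` overlaps `[c, d]`. -/
theorem overlaps_of_rel {D : IntervalFamily N} {c d u v : N}
    (h : (D.orth ⊓ (D ⊔ interval c d)).rel u v) {u' v' : N} (hu : u ≤ u') (huv : u' < v')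
    (hv : v' ≤ v) : ¬ v' ≤ c ∧ ¬ d ≤ u' := by
  obtain ⟨h₁, h₂⟩ := inf_rel.1 (IntervalFamily.mono _ h hu huv hv)
  -- Everything in the join overlaps each interval orthogonal to both D and [c, d] trivially or not
  -- at all; so such an interval cannot itself lie in the join.
  have hW : D ⊔ interval c d ≤ (D.orth ⊓ (interval c d).orth).orth :=
    sup_le ((le_orth_orth D).trans (orth_antitone inf_le_left))
      ((le_orth_orth _).trans (orth_antitone inf_le_right))
  rw [← not_or]
  intro hor
  have h₃ : (interval c d).orth.rel u' v' :=
    ⟨huv, fun p q hpq => hor.imp (fun h => h.trans hpq.1) fun h => hpq.2.2.trans h⟩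
  rcases (hW _ _ h₂).2 u' v' (inf_rel.2 ⟨h₁, h₃⟩) with h | h <;> exact h.not_gt huv

theorem exists_rel_of_lt [CofiniteAbove N] [WellFoundedLT N] {D E : IntervalFamily N}
    (h : D < E) : ∃ a b, a ⋖ b ∧ D.orth.rel a b ∧ E.rel a b := by
  have hne : D.orth ⊓ E ≠ ⊥ := fun h' => h.not_ge (le_of_orth_inf_eq_bot h.le h')
  obtain ⟨a, b, hab, hle⟩ := exists_interval_le hne
  exact ⟨a, b, hab, inf_rel.1 ((interval_le hab.lt).1 hle)⟩

/-- If no three consecutive covers belong to `D.orth ⊓ (D ⊔ interval c d)`, then chains between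
`D` and `D ⊔ interval c d` have at most three elements. -/
theorem heightAtMost_Icc [CofiniteAbove N] [WellFoundedLT N] {D A : IntervalFamily N}
    (h : ∀ u v u' v' u'' v'', u ⋖ v → u' ⋖ v' → u'' ⋖ v'' → v ≤ u' → v' ≤ u'' →
      (D.orth ⊓ (D ⊔ A)).rel u v → (D.orth ⊓ (D ⊔ A)).rel u' v' →
      (D.orth ⊓ (D ⊔ A)).rel u'' v'' → False) :
    HeightAtMost (Set.Icc D (D ⊔ A)) 2 := by
  intro s hs
  by_contra hcard
  have hcard' : ((4 : ℕ) : ℕ∞) ≤ s.encard := by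
    have := Order.add_one_le_of_lt (not_le.1 hcard)
    refine le_trans (le_of_eq ?_) this
    norm_num
  obtain ⟨f, hf, -⟩ := hs.exists_strictMono_of_le_encard hcard'
  have hstep : ∀ i j : Fin 4, i < j → ∃ a b, a ⋖ b ∧ (D.orth ⊓ (D ⊔ A)).rel a b ∧
      (f i).1.orth.rel a b ∧ (f j).1.rel a b := by
    intro i j hij
    obtain ⟨a, b, hab, h₁, h₂⟩ := exists_rel_of_lt (D := (f i).1) (E := (f j).1) (hf hij)
    exact ⟨a, b, hab, inf_rel.2 ⟨orth_antitone (f i).2.1 _ _ h₁, (f j).2.2 _ _ h₂⟩, h₁, h₂⟩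
  obtain ⟨a₀, b₀, c₀, z₀, -, p₀⟩ := hstep 0 1 (by decide)
  obtain ⟨a₁, b₁, c₁, z₁, o₁, p₁⟩ := hstep 1 2 (by decide)
  obtain ⟨a₂, b₂, c₂, z₂, o₂, -⟩ := hstep 2 3 (by decide)
  have hf₁₂ : (f 1).1 ≤ (f 2).1 := (hf (by decide : (1 : Fin 4) < 2)).le
  have l₀ := c₀.lt
  have l₁ := c₁.lt
  have l₂ := c₂.lt
  -- Any two of the three covers are comparable as intervals. Two of the eight sign patterns are
  -- cyclic and impossible; each other one sorts the covers.
  rcases o₁.2 _ _ p₀ with h₁ | h₁ <;> rcases o₂.2 _ _ p₁ with h₂ | h₂ <;>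
    rcases o₂.2 _ _ (hf₁₂ _ _ p₀) with h₃ | h₃
  · exact h _ _ _ _ _ _ c₂ c₁ c₀ h₂ h₁ z₂ z₁ z₀
  · exact h₃.not_gt (l₂.trans_le (h₂.trans (l₁.le.trans (h₁.trans l₀.le))))
  · exact h _ _ _ _ _ _ c₁ c₂ c₀ h₂ h₃ z₁ z₂ z₀
  · exact h _ _ _ _ _ _ c₁ c₀ c₂ h₁ h₃ z₁ z₀ z₂
  · exact h _ _ _ _ _ _ c₂ c₀ c₁ h₃ h₁ z₂ z₀ z₁
  · exact h _ _ _ _ _ _ c₀ c₂ c₁ h₃ h₂ z₀ z₂ z₁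
  · exact h₃.not_gt (l₀.trans_le (h₁.trans (l₁.le.trans (h₂.trans l₂.le))))
  · exact h _ _ _ _ _ _ c₀ c₁ c₂ h₁ h₂ z₀ z₁ z₂

/-! ### Direct irreducibility -/

/-- The element D corresponding to (⊤, ⊥) is central. The first component of an atom, paired with ⊥,
is below that atom, so it is the atom or ⊥; thus every atom lies below D or below its
orthocomplement. -/
theorem isDirectlyIrreducible_orth [CofiniteAbove N] [WellFoundedLT N]
    [Nontrivial (IntervalFamily N)]
    (h : ∀ D : IntervalFamily N, (∀ c d, c ⋖ d → D.rel c d ∨ D.orth.rel c d) →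
      D = ⊤ ∨ D.orth = ⊤) :
    IsDirectlyIrreducible (orth : IntervalFamily N → IntervalFamily N) := by
  refine ⟨inferInstance, ?_⟩
  intro β γ _ _ _ _ pβ pγ hβ hγ f hf
  have htop : f ⊤ = (⊤, ⊤) := f.map_top
  have hbot : f ⊥ = (⊥, ⊥) := f.map_bot
  have he : f (f.symm (⊤, ⊥)).orth = (⊥, ⊤) := by
    rw [hf, f.apply_symm_apply]
    exact Prod.ext hβ.map_top hγ.map_bot
  have hcov : ∀ c d, c ⋖ d →
      (f.symm (⊤, ⊥)).rel c d ∨ (f.symm (⊤, ⊥)).orth.rel c d := by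
    intro c d hcd
    rw [← interval_le hcd.lt, ← interval_le hcd.lt, ← f.le_iff_le,
      ← f.le_iff_le (x := interval c d), he, f.apply_symm_apply]
    have hle : f.symm ((f (interval c d)).1, ⊥) ≤ interval c d := by
      rw [← f.le_iff_le, f.apply_symm_apply]
      exact ⟨le_rfl, bot_le⟩
    rcases (isAtom_interval hcd).le_iff.1 hle with h | h
    · right
      have h' := (f.apply_symm_apply _).symm.trans ((congrArg f h).trans hbot)
      exact ⟨(congrArg Prod.fst h').le, le_top⟩
    · left
      rw [← h, f.apply_symm_apply]
      exact ⟨le_top, le_rfl⟩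
  rcases h (f.symm (⊤, ⊥)) hcov with h | h
  · right
    have h' := congrArg Prod.snd
      ((f.apply_symm_apply (⊤, ⊥)).symm.trans ((congrArg f h).trans htop))
    exact subsingleton_of_bot_eq_top h'
  · left
    have h' := congrArg Prod.fst (he.symm.trans ((congrArg f h).trans htop))
    exact subsingleton_of_bot_eq_top h'

theorem eq_top_of_covBy [CofiniteAbove N] [WellFoundedLT N] {D : IntervalFamily N}
    (h : ∀ c d, c ⋖ d → D.rel c d) : D = ⊤ := by
  refine top_le_iff.1 (le_of_orth_inf_eq_bot le_top (eq_bot_iff_rel.2 fun a b hab => ?_))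
  obtain ⟨c, hac, -, hc⟩ := exists_covBy_rel (inf_rel.1 hab).1
  rcases hc.2 _ _ (h a c hac) with h | h <;> exact h.not_gt hac.lt

end IntervalFamily

/-! ### The Rieger-Nishimura lattice without its top -/

namespace RNNode

theorem lt_def {a b : RNNode} : a < b ↔ a ≤ b ∧ a.i + (a.i + a.j) < b.i + (b.i + b.j) := by
  rw [lt_iff_le_not_ge, le_def, le_def]
  omega

instance : NoMaxOrder RNNode where
  exists_gt a := ⟨⟨a.i + 1, a.j, a.j_le, by omega⟩, lt_def.2 ⟨le_def.2 (by dsimp only; omega),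
    by dsimp only; omega⟩⟩

instance : CofiniteAbove RNNode where
  finite_not_le c := by
    refine Set.Finite.of_injOn (f := fun a : RNNode => (a.i, a.j))
      (t := Set.Iio (c.i + c.j + 1) ×ˢ Set.Iio 4) ?_ ?_
      ((Set.finite_Iio _).prod (Set.finite_Iio _))
    · intro a ha
      have h := mt le_def.2 ha
      have := a.j_le
      simp only [Set.mem_prod, Set.mem_Iio]
      omega
    · intro a _ b _ h
      exact RNNode.ext (congrArg Prod.fst h) (congrArg Prod.snd h)

/-! ### Covers overlapping a given cover, in coordinates -/

/-- In coordinates: no nondegenerate subinterval of `[u, v]` lies below `c` or above `d`. -/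
def Overlaps (c₁ c₂ d₁ d₂ u₁ u₂ v₁ v₂ : ℕ) : Prop :=
  ¬ (v₁ ≤ c₁ ∧ v₂ ≤ c₂) ∧ ¬ (d₁ ≤ u₁ ∧ d₂ ≤ u₂) ∧
  (u₁ ≤ c₁ → u₂ ≤ c₂ → (v₁ ≤ u₁ ∨ c₁ ≤ u₁) ∧ (v₂ ≤ u₂ ∨ c₂ ≤ u₂)) ∧
  (d₁ ≤ v₁ → d₂ ≤ v₂ → (v₁ ≤ u₁ ∨ v₁ ≤ d₁) ∧ (v₂ ≤ u₂ ∨ v₂ ≤ d₂))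

/-- The four clauses test [u, v] twice, then [u, v ⊓ c] and [u ⊔ d, v], which must be degenerate
when u ≤ c, respectively d ≤ v. -/
theorem overlaps_of_forall {c d u v : RNNode} (huv : u < v)
    (h : ∀ u' v', u ≤ u' → u' < v' → v' ≤ v → ¬ v' ≤ c ∧ ¬ d ≤ u') :
    Overlaps c.i (c.i + c.j) d.i (d.i + d.j) u.i (u.i + u.j) v.i (v.i + v.j) := by
  refine ⟨fun h' => (h u v le_rfl huv le_rfl).1 (le_def.2 h'),
    fun h' => (h u v le_rfl huv le_rfl).2 (le_def.2 h'), fun h₁ h₂ => ?_, fun h₁ h₂ => ?_⟩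
  · have hle : u ≤ v ⊓ c := le_inf huv.le (le_def.2 ⟨h₁, h₂⟩)
    have hge : v ⊓ c ≤ u := by
      by_contra hne
      exact (h u (v ⊓ c) le_rfl (lt_of_le_not_ge hle hne) inf_le_left).1 inf_le_right
    have h₃ : min v.i c.i ≤ u.i := (le_def.1 hge).1
    have h₄ := (le_def.1 hge).2
    change min v.i c.i + (min (v.i + v.j) (c.i + c.j) - min v.i c.i) ≤ _ at h₄
    omega
  · have hle : u ⊔ d ≤ v := sup_le huv.le (le_def.2 ⟨h₁, h₂⟩)
    have hge : v ≤ u ⊔ d := by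
      by_contra hne
      exact (h (u ⊔ d) v le_sup_left (lt_of_le_not_ge hle hne) le_rfl).2 le_sup_right
    have h₃ : v.i ≤ max u.i d.i := (le_def.1 hge).1
    have h₄ := (le_def.1 hge).2
    change _ ≤ max u.i d.i + (max (u.i + u.j) (d.i + d.j) - max u.i d.i) at h₄
    omega

section Coordinates

variable {c₁ c₂ d₁ d₂ u₁ u₂ v₁ v₂ u₁' u₂' v₁' v₂' : ℕ}

/-- Since v ≰ c, v ≤ u' and d ≰ u', the nodes v and u' lie both to the upper left or both to the
lower right of [c, d]. The strip leaves at most three nodes there. The remaining bad cases have v =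
u' and are excluded by `hm`, applied to the merged interval [u, v']. -/
theorem rank_bounds_of_vertical (hc : c₁ ≤ c₂ ∧ c₂ ≤ c₁ + 3) (hd : d₁ ≤ d₂ ∧ d₂ ≤ d₁ + 3)
    (hu : u₁ ≤ u₂ ∧ u₂ ≤ u₁ + 3) (hv : v₁ ≤ v₂ ∧ v₂ ≤ v₁ + 3)
    (hu' : u₁' ≤ u₂' ∧ u₂' ≤ u₁' + 3) (hv' : v₁' ≤ v₂' ∧ v₂' ≤ v₁' + 3)
    (hcd : d₁ = c₁ ∧ d₂ = c₂ + 1)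
    (h : (v₁ = u₁ ∧ v₂ = u₂ + 1) ∨ (v₁ = u₁ + 1 ∧ v₂ = u₂))
    (h' : (v₁' = u₁' ∧ v₂' = u₂' + 1) ∨ (v₁' = u₁' + 1 ∧ v₂' = u₂'))
    (hle : v₁ ≤ u₁' ∧ v₂ ≤ u₂') (ho : Overlaps c₁ c₂ d₁ d₂ u₁ u₂ v₁ v₂)
    (ho' : Overlaps c₁ c₂ d₁ d₂ u₁' u₂' v₁' v₂')
    (hm : v₁ = u₁' → v₂ = u₂' → Overlaps c₁ c₂ d₁ d₂ u₁ u₂ v₁' v₂') :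
    (c₁ = c₂ → v₁ + v₂ ≤ c₁ + c₂ ∧ c₁ + c₂ ≤ u₁' + u₂') ∧
      (c₁ < c₂ → v₁ + v₂ ≤ d₁ + d₂ ∧ d₁ + d₂ ≤ u₁' + u₂') := by
  unfold Overlaps at *
  obtain ⟨rfl, rfl⟩ := hcd
  rcases h with ⟨rfl, rfl⟩ | ⟨rfl, rfl⟩ <;> rcases h' with ⟨rfl, rfl⟩ | ⟨rfl, rfl⟩ <;> omega

/-- The argument is the same with the other kind of edge; the exceptional position of c is now the
edge y = x + 3 of the strip instead of y = x. -/
theorem rank_bounds_of_horizontal (hc : c₁ ≤ c₂ ∧ c₂ ≤ c₁ + 3) (hd : d₁ ≤ d₂ ∧ d₂ ≤ d₁ + 3)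
    (hu : u₁ ≤ u₂ ∧ u₂ ≤ u₁ + 3) (hv : v₁ ≤ v₂ ∧ v₂ ≤ v₁ + 3)
    (hu' : u₁' ≤ u₂' ∧ u₂' ≤ u₁' + 3) (hv' : v₁' ≤ v₂' ∧ v₂' ≤ v₁' + 3)
    (hcd : d₁ = c₁ + 1 ∧ d₂ = c₂)
    (h : (v₁ = u₁ ∧ v₂ = u₂ + 1) ∨ (v₁ = u₁ + 1 ∧ v₂ = u₂))
    (h' : (v₁' = u₁' ∧ v₂' = u₂' + 1) ∨ (v₁' = u₁' + 1 ∧ v₂' = u₂'))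
    (hle : v₁ ≤ u₁' ∧ v₂ ≤ u₂') (ho : Overlaps c₁ c₂ d₁ d₂ u₁ u₂ v₁ v₂)
    (ho' : Overlaps c₁ c₂ d₁ d₂ u₁' u₂' v₁' v₂')
    (hm : v₁ = u₁' → v₂ = u₂' → Overlaps c₁ c₂ d₁ d₂ u₁ u₂ v₁' v₂') :
    (c₂ = c₁ + 3 → v₁ + v₂ ≤ c₁ + c₂ ∧ c₁ + c₂ ≤ u₁' + u₂') ∧
      (c₂ < c₁ + 3 → v₁ + v₂ ≤ d₁ + d₂ ∧ d₁ + d₂ ≤ u₁' + u₂') := by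
  unfold Overlaps at *
  obtain ⟨rfl, rfl⟩ := hcd
  rcases h with ⟨rfl, rfl⟩ | ⟨rfl, rfl⟩ <;> rcases h' with ⟨rfl, rfl⟩ | ⟨rfl, rfl⟩ <;> omega

end Coordinates

theorem coord_bounds (a : RNNode) : a.i ≤ a.i + a.j ∧ a.i + a.j ≤ a.i + 3 := by
  have := a.j_le
  omega

theorem covBy_coord {a b : RNNode} (h : a ⋖ b) :
    (b.i = a.i ∧ b.i + b.j = a.i + a.j + 1) ∨ (b.i = a.i + 1 ∧ b.i + b.j = a.i + a.j) := by
  rcases covBy_iff_edge.1 h with h | h <;> omega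

open IntervalFamily

/-- Two consecutive covers between `D` and `D ⊔ interval c d` are separated by a rank that depends
only on `c` and `d`. -/
theorem exists_rank_between {c d : RNNode} (hcd : c ⋖ d) (D : IntervalFamily RNNode) :
    ∃ r, ∀ u v u' v', u ⋖ v → u' ⋖ v' → v ≤ u' → (D.orth ⊓ (D ⊔ interval c d)).rel u v →
      (D.orth ⊓ (D ⊔ interval c d)).rel u' v' →
      v.i + (v.i + v.j) ≤ r ∧ r ≤ u'.i + (u'.i + u'.j) := by
  have ho : ∀ {u v}, (D.orth ⊓ (D ⊔ interval c d)).rel u v →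
      Overlaps c.i (c.i + c.j) d.i (d.i + d.j) u.i (u.i + u.j) v.i (v.i + v.j) := fun h =>
    overlaps_of_forall (IntervalFamily.lt _ h) fun _ _ h₁ h₂ h₃ => overlaps_of_rel h h₁ h₂ h₃
  have hm : ∀ {u v u' v' : RNNode}, (D.orth ⊓ (D ⊔ interval c d)).rel u v →
      (D.orth ⊓ (D ⊔ interval c d)).rel u' v' → v.i = u'.i → v.i + v.j = u'.i + u'.j →
      Overlaps c.i (c.i + c.j) d.i (d.i + d.j) u.i (u.i + u.j) v'.i (v'.i + v'.j) := by
    intro u v u' v' h h' h₁ h₂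
    obtain rfl : v = u' := RNNode.ext h₁ (by omega)
    have huv := IntervalFamily.lt _ h
    have huv' := IntervalFamily.lt _ h'
    have := IntervalFamily.merge _ h h' (lt_irrefl v) (huv.trans huv').asymm
    rw [inf_eq_left.2 huv.le, sup_eq_right.2 huv'.le] at this
    exact ho this
  have hc := c.coord_bounds
  have hd := d.coord_bounds
  rcases covBy_coord hcd with h | h
  · refine ⟨if c.j = 0 then c.i + (c.i + c.j) else d.i + (d.i + d.j), ?_⟩
    intro u v u' v' huv huv' hle hz hz'
    have := rank_bounds_of_vertical hc hd u.coord_bounds v.coord_bounds u'.coord_bounds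
      v'.coord_bounds h (covBy_coord huv) (covBy_coord huv') (le_def.1 hle) (ho hz) (ho hz')
      (hm hz hz')
    split_ifs with hj
    · exact this.1 (by omega)
    · exact this.2 (by omega)
  · refine ⟨if c.j = 3 then c.i + (c.i + c.j) else d.i + (d.i + d.j), ?_⟩
    intro u v u' v' huv huv' hle hz hz'
    have := rank_bounds_of_horizontal hc hd u.coord_bounds v.coord_bounds u'.coord_bounds
      v'.coord_bounds h (covBy_coord huv) (covBy_coord huv') (le_def.1 hle) (ho hz) (ho hz')
      (hm hz hz')
    split_ifs with hj
    · exact this.1 (by omega)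
    · exact this.2 (by omega)

theorem hasCoveringProperty_intervalFamily : HasCoveringProperty (IntervalFamily RNNode) 2 := by
  refine ⟨inferInstance, fun A D hA => ?_⟩
  obtain ⟨c, d, hcd, rfl⟩ := exists_eq_interval hA
  obtain ⟨r, hr⟩ := exists_rank_between hcd D
  -- The middle one of three consecutive covers would have both ends at rank r.
  refine heightAtMost_Icc fun u v u' v' u'' v'' h h' h'' hl hl' hz hz' hz'' => ?_
  have h₁ := (hr _ _ _ _ h h' hl hz hz').2
  have h₂ := (hr _ _ _ _ h' h'' hl' hz' hz'').1
  have h₃ := (lt_def.1 h'.lt).2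
  omega

/-- A cover overlapping a member of D cannot be orthogonal to D, so it belongs to D. Starting from
[a₀₁, a₀₂], overlaps lead through a zigzag of edges from each level i to level i + 1, and every edge
coincides with or overlaps one of the edges reached. -/
theorem eq_top_of_rel {D : IntervalFamily RNNode}
    (h : ∀ c d, c ⋖ d → D.rel c d ∨ D.orth.rel c d)
    (h₀ : D.rel ⟨0, 1, by omega, by omega⟩ ⟨0, 2, by omega, by omega⟩) : D = ⊤ := by
  have step : ∀ {p q : RNNode}, D.rel p q → ∀ r s : RNNode, Edge r s → ¬ q ≤ r → ¬ s ≤ p →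
      D.rel r s := fun hpq r s hrs h₁ h₂ =>
    (h r s (covBy_iff_edge.2 hrs)).resolve_right fun h₃ =>
      (h₃.2 _ _ hpq).elim h₂ h₁
  have hW : ∀ i : ℕ, D.rel ⟨i, 1, by omega, by omega⟩ ⟨i, 2, by omega, by omega⟩ →
      D.rel ⟨i + 1, 0, by omega, by omega⟩ ⟨i + 1, 1, by omega, by omega⟩ := fun i h =>
    step h _ _ (Or.inl ⟨rfl, rfl⟩) (by rw [le_def]; dsimp only; omega)
      (by rw [le_def]; dsimp only; omega)
  have hH : ∀ i : ℕ, D.rel ⟨i, 1, by omega, by omega⟩ ⟨i, 2, by omega, by omega⟩ →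
      D.rel ⟨i, 2, by omega, by omega⟩ ⟨i + 1, 1, by omega, by omega⟩ := fun i h =>
    step (hW i h) _ _ (Or.inr ⟨rfl, rfl⟩) (by rw [le_def]; dsimp only; omega)
      (by rw [le_def]; dsimp only; omega)
  have hU : ∀ i : ℕ, D.rel ⟨i, 1, by omega, by omega⟩ ⟨i, 2, by omega, by omega⟩ →
      D.rel ⟨i, 2, by omega, by omega⟩ ⟨i, 3, by omega, by omega⟩ := fun i h =>
    step (hH i h) _ _ (Or.inl ⟨rfl, rfl⟩) (by rw [le_def]; dsimp only; omega)
      (by rw [le_def]; dsimp only; omega)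
  have hV : ∀ i : ℕ, D.rel ⟨i, 1, by omega, by omega⟩ ⟨i, 2, by omega, by omega⟩ := by
    intro i
    induction i with
    | zero => exact h₀
    | succ i ih =>
      exact step (hU i ih) _ _ (Or.inl ⟨rfl, rfl⟩) (by rw [le_def]; dsimp only; omega)
        (by rw [le_def]; dsimp only; omega)
  refine eq_top_of_covBy fun c d hcd => ?_
  have hE := covBy_iff_edge.1 hcd
  have hj := c.j_le
  have hj' := d.j_le
  have h₁ := step (hV c.i) c d hE
  have h₂ := step (hH c.i (hV c.i)) c d hE
  have h₃ := step (hV (c.i + 1)) c d hE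
  -- This is used only for c.j = 0, where c.i ≥ 1 and the subtraction is not truncated.
  have h₄ := step (hW (c.i - 1) (hV _)) c d hE
  have h₅ := c.ne_zero
  simp only [le_def] at h₁ h₂ h₃ h₄
  rcases hE with hE | hE
  · obtain hj | hj | hj : c.j = 0 ∨ c.j = 1 ∨ c.j = 2 := by omega
    · exact h₄ (by omega) (by omega)
    · exact h₁ (by omega) (by omega)
    · exact h₂ (by omega) (by omega)
  · obtain hj | hj | hj : c.j = 1 ∨ c.j = 2 ∨ c.j = 3 := by omega
    · exact h₁ (by omega) (by omega)
    · exact h₂ (by omega) (by omega)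
    · exact h₃ (by omega) (by omega)

theorem isDirectlyIrreducible_intervalFamily :
    IsDirectlyIrreducible (orth : IntervalFamily RNNode → IntervalFamily RNNode) := by
  have : Nontrivial (IntervalFamily RNNode) := by
    obtain ⟨a, ha⟩ := exists_gt (⊥ : RNNode)
    exact ⟨⊥, interval ⊥ a, fun h => eq_bot_iff_rel.1 h.symm ⊥ a ⟨le_rfl, ha, le_rfl⟩⟩
  refine isDirectlyIrreducible_orth fun D h => ?_
  rcases h ⟨0, 1, by omega, by omega⟩ ⟨0, 2, by omega, by omega⟩
    (covBy_iff_edge.2 (Or.inl ⟨rfl, rfl⟩)) with h₀ | h₀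
  · exact Or.inl (eq_top_of_rel h h₀)
  · refine Or.inr (eq_top_of_rel (fun c d hcd => ?_) h₀)
    rw [orth_orth]
    exact (h c d hcd).symm

end RNNode

theorem mainTheorem3 :
    ∃ _ : CompleteLattice (KalmbachStar RiegerNishimura),
      (∀ x y : KalmbachStar RiegerNishimura, x ≤ y ↔ x.Below y) ∧
      (⊥ : KalmbachStar RiegerNishimura) = KalmbachStar.zero RiegerNishimura ∧
      (⊤ : KalmbachStar RiegerNishimura) = KalmbachStar.one RiegerNishimura ∧
      IsOrthomodular (KalmbachStar.perp : KalmbachStar RiegerNishimura → KalmbachStar RiegerNishimura) ∧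
      IsDirectlyIrreducible (KalmbachStar.perp : KalmbachStar RiegerNishimura → KalmbachStar RiegerNishimura) ∧
      IsCompactlyGenerated (KalmbachStar RiegerNishimura) ∧
      HasCoveringProperty (KalmbachStar RiegerNishimura) 2 ∧
      ¬ HasFiniteHeight (KalmbachStar RiegerNishimura) := by
  let _ : CompleteLattice (KalmbachStar RiegerNishimura) := KalmbachStar.completeLattice
  let e : KalmbachStar RiegerNishimura ≃o IntervalFamily RNNode := KalmbachStar.familyIso
  refine ⟨inferInstance, fun x y => KalmbachStar.le_iff_below, ?_, ?_, ?_, ?_, ?_, ?_, ?_⟩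
  · exact e.injective (e.map_bot.trans KalmbachStar.family_zero.symm)
  · exact e.injective (e.map_top.trans KalmbachStar.family_one.symm)
  · exact IntervalFamily.isOrthomodular_orth.of_orderIso e KalmbachStar.familyIso_perp
  · exact RNNode.isDirectlyIrreducible_intervalFamily.of_orderIso e KalmbachStar.familyIso_perp
  · exact IsCompactlyGenerated.of_orderIso e
  · exact RNNode.hasCoveringProperty_intervalFamily.of_orderIso e
  · intro h
    obtain ⟨f, hf⟩ := Nat.exists_strictMono RNNode
    exact not_hasFiniteHeight_of_strictMono (IntervalFamily.strictMono_interval_bot.comp hf)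
      (h.of_orderEmbedding e.symm.toOrderEmbedding)
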